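/- Let $(T_n)_{n\ge 1}$ be a uniform random recursive tree: $T_1$ consists of the single vertex $1$ (the root), and for each $n\ge 1$ the tree $T_{n+1}$, with vertex set $[n+1]=\{1,\dots,n+1\}$, is obtained from $T_n$ by adding the vertex $n+1$ and joining it by an edge to a vertex $U_n$ chosen uniformly at random from $[n]$, the choices $U_1,U_2,\dots$ being independent. For a vertex $v$ of $T_n$, let the betweenness centrality $\mathcal B_{T_n}(v)$ be the number of ordered pairs $(s,t)$ of vertices of $T_n$, both different from $v$, such that the path from $s$ to $t$ in $T_n$ passes through $v$. Say that $v$ is more central than $w$ in $T_n$ if $\mathcal B_{T_n}(v)>\mathcal B_{T_n}(w)$, or if $\mathcal B_{T_n}(v)=\mathcal B_{T_n}(w)$ and $v>w$. Let $R_n = 1+|\{v\in[n] : v \text{ is more central than } 1 \text{ in } T_n\}|$ be the betweenness rank of the root. Then: (i) the rank $R_n$ of the root is persistent, that is, there exist almost surely finite integer-valued random variables $N,K$ such that, almost surely, $R_n=K$ for all $n\ge N$; (ii) almost surely, only finitely many vertices $v$ are more central than the root in $T_n$ for at least one $n\ge v$; (iii) for any two distinct vertices $v,w$, almost surely there is a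 finite $N$ such that either $v$ is more central than $w$ in $T_n$ for all $n\ge N$, or $w$ is more central than $v$ in $T_n$ for all $n\ge N$. -/

import Mathlib

open MeasureTheory ProbabilityTheory

/-- `U n` is the vertex to which vertex `n + 1` is attached (`n ≥ 1`): the attachment vertices
`U 1, U 2, …` are independent and `U n` is uniform on `[n] = {1, …, n}`.
The value of `U 0` plays no role. -/
structure IsUniformAttachment {Ω : Type*} [MeasurableSpace Ω] (μ : Measure Ω)
    (U : ℕ → Ω → ℕ) : Prop where
  measurable : ∀ n, 1 ≤ n → Measurable (U n)
  uniform : ∀ n, 1 ≤ n → ∀ i ∈ Finset.Icc 1 n, μ {ω | U n ω = i} = (n : ENNReal)⁻¹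
  indep : iIndepFun (fun n : ℕ => U (n + 1)) μ

/-- The tree `T_n` on the vertex set `[n] = {1, …, n}` with edges `{u m, m + 1}`, `1 ≤ m < n`. -/
def attachmentTree (u : ℕ → ℕ) (n : ℕ) : SimpleGraph (Finset.Icc 1 n) :=
  SimpleGraph.fromRel fun i j => ∃ m, 1 ≤ m ∧ (i : ℕ) = u m ∧ (j : ℕ) = m + 1

open Classical in
/-- Betweenness centrality of a vertex `v` of a finite tree: the number of (ordered) pairs
`(s, t)` of vertices different from `v` such that the path from `s` to `t` passes through `v`. -/
noncomputable def betweenness {V : Type*} [Fintype V] (T : SimpleGraph V) (v : V) : ℕ :=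
  ∑ s ∈ Finset.univ.erase v, ∑ t ∈ Finset.univ.erase v,
    if ∃ p : T.Walk s t, p.IsPath ∧ v ∈ p.support then 1 else 0

/-- `v` is ranked before `w`: it has larger betweenness or, the betweenness being equal,
the larger label (pessimistic tie-breaking). -/
def MoreCentral {V : Type*} [Fintype V] [LT V] (T : SimpleGraph V) (v w : V) : Prop :=
  betweenness T w < betweenness T v ∨ (betweenness T v = betweenness T w ∧ w < v)

/-- The vertices labelled `v` and `w` both belong to `T_n`, and `v` is more central than `w`. -/
def MoreCentralAt (u : ℕ → ℕ) (n v w : ℕ) : Prop :=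
  ∃ (hv : v ∈ Finset.Icc 1 n) (hw : w ∈ Finset.Icc 1 n),
    MoreCentral (attachmentTree u n) ⟨v, hv⟩ ⟨w, hw⟩

open Classical in
/-- The rank `γ_n(w)` of the vertex labelled `w` in `T_n`. -/
noncomputable def betweennessRank (u : ℕ → ℕ) (n w : ℕ) : ℕ :=
  1 + ((Finset.Icc 1 n).filter fun v => MoreCentralAt u n v w).card

/-- The betweenness rank of the root, `R_n = γ_n(1)`. -/
noncomputable def rootRank (u : ℕ → ℕ) (n : ℕ) : ℕ := betweennessRank u n 1

/-- A sequence of integer-valued random variables is persistent if there are (almost surely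
finite) integer-valued random variables `N` and `K` with `X n = K` for all `n ≥ N`,
almost surely. -/
def Persistent {Ω : Type*} [MeasurableSpace Ω] (μ : Measure Ω) (X : ℕ → Ω → ℕ) : Prop :=
  ∃ N K : Ω → ℕ, Measurable N ∧ Measurable K ∧ ∀ᵐ ω ∂μ, ∀ n, N ω ≤ n → X n ω = K ω

/-! A pair of vertices other than `v` fails to be separated by `v` exactly when both lie in one
component of `T_n - v`. Hence betweenness equals `(n - 1) ^ 2` minus the sum of squared component
sizes, `branchCost` (`betweenness_add_branchCost`), and being more central means having smaller
cost, up to the tie-break.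

Almost surely (`ae_regularAttachment`) each subtree occupies an asymptotic positive fraction of the
tree, subtrees of late vertices are uniformly small, and every vertex has infinitely many children.
Convergence of the fractions comes from the Pólya urn martingale, smallness from a quadratic urn
martingale with Doob's inequality and Borel-Cantelli, positivity from an anti-concentration bound,
and the children from the second Borel-Cantelli lemma. On such a sequence `branchCost / n ^ 2`
converges for every vertex. A late vertex has almost the whole tree in one component, while the root
has two branches of positive density; so only finitely many vertices ever beat the root. Two
vertices whose limiting costs differ are eventually ordered.

What remains is that the limits for `v < w` almost surely differ (`ae_not_asymptoticTie`). No
density of the limit law is needed. Rehanging a late subtree from one branch at `w` to another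
leaves the cost of `v` unchanged but alters that of `w` by order `n ^ 2`, so a tie cannot survive
both choices of parent (`not_asymptoticTie_both`). Thus, for almost every `u` in the tie event,
resampling any late coordinate destroys the tie with probability bounded below. But every event is
approximable by cylinders, so resampling a late coordinate leaves it with vanishing probability;
hence the tie event is null.

Finiteness of the competitors and eventual ordering against each one make the rank of the root
eventually constant. -/

/-! ### Descendants in a recursive tree -/

/-- `Desc u v s`: the vertex `s` belongs to the subtree rooted at `v` when each vertex `m + 1` is
attached to `u m`. -/
inductive Desc (u : ℕ → ℕ) (v : ℕ) : ℕ → Prop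
  | refl : Desc u v v
  | step {m : ℕ} : u m ≤ m → Desc u v (u m) → Desc u v (m + 1)

/-- The attachment sequence `u` describes a tree: each `m + 1` is attached to a vertex of `[m]`. -/
def ValidAttachment (u : ℕ → ℕ) : Prop := ∀ m, 1 ≤ m → 1 ≤ u m ∧ u m ≤ m

noncomputable instance (u : ℕ → ℕ) (v : ℕ) : DecidablePred (Desc u v) := Classical.decPred _

/-- The number of vertices of `[n]` in the subtree rooted at `v`. -/
noncomputable def subtreeSize (u : ℕ → ℕ) (v n : ℕ) : ℕ :=
  ((Finset.Icc 1 n).filter (Desc u v)).card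

namespace Desc

variable {u : ℕ → ℕ} {v a b s m : ℕ}

theorem le (h : Desc u v s) : v ≤ s := by
  induction h with
  | refl => exact le_rfl
  | step h1 _ ih => omega

theorem succ_iff : Desc u v (m + 1) ↔ m + 1 = v ∨ (u m ≤ m ∧ Desc u v (u m)) := by
  constructor
  · intro h
    generalize hs : m + 1 = s at h
    cases h with
    | refl => exact Or.inl rfl
    | step h1 h2 =>
      obtain rfl : m = _ := Nat.succ_injective hs
      exact Or.inr ⟨h1, h2⟩
  · rintro (rfl | ⟨h1, h2⟩)
    · exact refl
    · exact step h1 h2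

theorem trans (h1 : Desc u a b) (h2 : Desc u b s) : Desc u a s := by
  induction h2 with
  | refl => exact h1
  | step h _ ih => exact step h ih

/-- The ancestors of a vertex form a chain ordered by label. -/
theorem of_le (h1 : Desc u a s) (h2 : Desc u b s) (hab : a ≤ b) : Desc u a b := by
  induction h1 with
  | refl =>
    obtain rfl := le_antisymm hab h2.le
    exact refl
  | @step m h h' ih =>
    rcases succ_iff.1 h2 with rfl | ⟨_, h3⟩
    · exact step h h'
    · exact ih h3

theorem congr {u' : ℕ → ℕ} (h : Desc u v s) (hu : ∀ m, m < s → u m = u' m) : Desc u' v s := by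
  induction h with
  | refl => exact refl
  | @step m h1 _ ih =>
    have := hu m (by omega)
    refine step (by omega) ?_
    rw [← this]
    exact ih fun k hk => hu k (by omega)

theorem one (hu : ValidAttachment u) : ∀ s, 1 ≤ s → Desc u 1 s := by
  intro s
  induction s using Nat.strong_induction_on with
  | _ s ih =>
    intro hs
    obtain ⟨m, rfl⟩ : ∃ m, s = m + 1 := ⟨s - 1, by omega⟩
    rcases Nat.eq_zero_or_pos m with rfl | hm
    · exact refl
    · obtain ⟨h1, h2⟩ := hu m hm
      exact step h2 (ih _ (by omega) h1)

/-- Cutting the edge from `m + 1` to its parent. -/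
theorem update_iff {j : ℕ} (ha : 1 ≤ a) (ham : a ≤ m) (hj : j ≤ m) :
    Desc (Function.update u m j) a s ↔
      Desc (Function.update u m 0) a s ∨ (Desc (Function.update u m 0) (m + 1) s ∧ Desc u a j) := by
  induction s using Nat.strong_induction_on with
  | _ s ih =>
    rcases s with _ | k
    · have h0 : ∀ w : ℕ → ℕ, ∀ b, 1 ≤ b → ¬ Desc w b 0 := fun w b hb h => by
        have := h.le; omega
      simp [h0 _ a ha, h0 _ (m + 1) (by omega)]
    · rw [succ_iff, succ_iff, succ_iff]
      by_cases hk : k = m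
      · subst hk
        have h1 : ¬ Desc (Function.update u k 0) a 0 := fun h => by have := h.le; omega
        have h2 : ¬ Desc (Function.update u k 0) (k + 1) 0 := fun h => by have := h.le; omega
        have h3 : Desc (Function.update u k j) a j ↔ Desc u a j := by
          constructor <;> intro h <;> refine h.congr fun i hi => ?_
          · rw [Function.update_of_ne (by omega)]
          · rw [Function.update_of_ne (by omega)]
        simp only [Function.update_self, h1, h2, h3, and_false, or_false, true_and, hj]
      · simp only [Function.update_of_ne hk]
        by_cases hu : u k ≤ k
        · rw [ih (u k) (by omega)]
          have : k + 1 ≠ m + 1 := by omega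
          simp only [this, hu, true_and, false_or]
          tauto
        · have : k + 1 ≠ m + 1 := by omega
          simp [hu, hk]

/-- Paths up to `a` stop before reading any attachment with index below `a`. -/
theorem update_of_lt {j : ℕ} (ham : m < a) : Desc (Function.update u m j) a s ↔ Desc u a s := by
  induction s using Nat.strong_induction_on with
  | _ s ih =>
    rcases s with _ | k
    · constructor <;> intro h <;> have := h.le <;> omega
    · rw [succ_iff, succ_iff]
      by_cases hk : k = m
      · subst hk
        have h0 : ∀ w : ℕ → ℕ, ∀ i, i ≤ k → ¬ Desc w a i := fun w b hb h => by
          have := h.le; omega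
        have h1 : ∀ w : ℕ → ℕ, ∀ i, ¬ (i ≤ k ∧ Desc w a i) := fun w i h => h0 w i h.1 h.2
        simp only [h1]
      · simp only [Function.update_of_ne hk]
        by_cases hu : u k ≤ k
        · rw [ih (u k) (by omega)]
        · simp [hu]

end Desc

/-! ### Subtree sizes and their change under rehanging -/

section SubtreeSize

variable {u : ℕ → ℕ} {v n m : ℕ}

theorem subtreeSize_congr {u' : ℕ → ℕ} (hu : ∀ m, m < n → u m = u' m) :
    subtreeSize u v n = subtreeSize u' v n := by
  unfold subtreeSize
  congr 1
  refine Finset.filter_congr fun s hs => ?_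
  rw [Finset.mem_Icc] at hs
  exact ⟨fun h => h.congr fun m hm => hu m (by omega),
    fun h => h.congr fun m hm => (hu m (by omega)).symm⟩

theorem subtreeSize_le : subtreeSize u v n ≤ n := by
  unfold subtreeSize
  exact (Finset.card_filter_le _ _).trans (by simp)

theorem subtreeSize_mono_right {k : ℕ} (h : n ≤ k) : subtreeSize u v n ≤ subtreeSize u v k :=
  Finset.card_le_card (Finset.filter_subset_filter _ (Finset.Icc_subset_Icc_right h))

theorem subtreeSize_eq_zero (h : n < v) : subtreeSize u v n = 0 := by
  unfold subtreeSize
  rw [Finset.card_eq_zero, Finset.filter_eq_empty_iff]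
  intro s hs hd
  have := hd.le
  rw [Finset.mem_Icc] at hs
  omega

theorem subtreeSize_self (hv : 1 ≤ v) : subtreeSize u v v = 1 := by
  unfold subtreeSize
  rw [Finset.card_eq_one]
  refine ⟨v, ?_⟩
  ext s
  simp only [Finset.mem_filter, Finset.mem_Icc, Finset.mem_singleton]
  constructor
  · rintro ⟨⟨_, h1⟩, h2⟩
    exact le_antisymm h1 h2.le
  · rintro rfl
    exact ⟨⟨hv, le_rfl⟩, Desc.refl⟩

theorem subtreeSize_pos (hv : 1 ≤ v) (hn : v ≤ n) : 1 ≤ subtreeSize u v n :=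
  (subtreeSize_self (u := u) hv).symm.le.trans (subtreeSize_mono_right hn)

theorem subtreeSize_one (hu : ValidAttachment u) : subtreeSize u 1 n = n := by
  unfold subtreeSize
  rw [Finset.filter_true_of_mem]
  · simp
  · intro s hs
    exact Desc.one hu s (Finset.mem_Icc.1 hs).1

theorem subtreeSize_lt (hv : 2 ≤ v) (hn : 1 ≤ n) : subtreeSize u v n < n := by
  unfold subtreeSize
  calc _ < (Finset.Icc 1 n).card := by
        refine Finset.card_lt_card (Finset.filter_ssubset.2 ⟨1, by simpa using hn, fun h => ?_⟩)
        have := h.le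
        omega
    _ = n := by simp

theorem subtreeSize_succ (hu : u n ≤ n) (hv : v ≤ n) :
    subtreeSize u v (n + 1) = subtreeSize u v n + if Desc u v (u n) then 1 else 0 := by
  unfold subtreeSize
  rw [← Finset.insert_Icc_right_eq_Icc_add_one (by omega), Finset.filter_insert]
  have h1 : Desc u v (n + 1) ↔ Desc u v (u n) := by
    rw [Desc.succ_iff]
    have h1 : n + 1 ≠ v := by omega
    simp only [h1, hu, true_and, false_or]
  by_cases h : Desc u v (u n)
  · rw [if_pos (h1.2 h), if_pos h, Finset.card_insert_of_notMem (by simp)]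
  · rw [if_neg (mt h1.1 h), if_neg h, Nat.add_zero]

theorem subtreeSize_update_of_lt {j : ℕ} (h : m < v) :
    subtreeSize (Function.update u m j) v n = subtreeSize u v n := by
  unfold subtreeSize
  simp only [Desc.update_of_lt h]

/-- Since `0` is not a vertex, setting `u m` to `0` cuts the edge above `m + 1`. The subtree of `m +
1` then moves as a block, and the new parent matters only through whether it lies below `v`. -/
theorem subtreeSize_update {j : ℕ} (hv : 1 ≤ v) (hvm : v ≤ m) (hj : j ≤ m) :
    subtreeSize (Function.update u m j) v n = subtreeSize (Function.update u m 0) v n +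
      if Desc u v j then subtreeSize u (m + 1) n else 0 := by
  rw [← subtreeSize_update_of_lt (u := u) (j := 0) (Nat.lt_succ_self m)]
  unfold subtreeSize
  simp only [Desc.update_iff hv hvm hj]
  split_ifs with h
  · simp only [h, and_true]
    rw [Finset.filter_or, Finset.card_union_of_disjoint]
    rw [Finset.disjoint_filter]
    intro s _ h1 h2
    rcases Desc.succ_iff.1 (h1.of_le h2 (by omega)) with h3 | ⟨_, h3⟩
    · omega
    · have := h3.le
      simp at this
      omega
  · simp [h]

end SubtreeSize

/-! ### Branches of a connected graph at a vertex -/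

namespace SimpleGraph

variable {V α : Type*} {G : SimpleGraph V} {v : V} {f : V → α}

theorem Walk.exists_adj_of_ne (hf : ∀ a b, G.Adj a b → a ≠ v → b ≠ v → f a = f b) {s : V}
    (q : G.Walk s v) (hs : s ≠ v) : ∃ b ∈ q.support, G.Adj v b ∧ f s = f b := by
  generalize hw : v = w at q
  induction q with
  | nil => exact absurd hw.symm hs
  | @cons a a' _ h q ih =>
    subst hw
    by_cases ha : a' = v
    · subst ha
      exact ⟨a, by simp, h.symm, rfl⟩
    · obtain ⟨b, hb, hb1, hb2⟩ := ih ha rfl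
      exact ⟨b, by simp [hb], hb1, (hf _ _ h hs ha).trans hb2⟩

theorem Walk.eq_of_notMem_support (hf : ∀ a b, G.Adj a b → a ≠ v → b ≠ v → f a = f b) {s t : V}
    (p : G.Walk s t) (hp : v ∉ p.support) : f s = f t := by
  induction p with
  | nil => rfl
  | @cons a b c h q ih =>
    rw [Walk.support_cons, List.mem_cons, not_or] at hp
    refine (hf _ _ h (Ne.symm hp.1) ?_).trans (ih hp.2)
    rintro rfl
    exact hp.2 q.start_mem_support

/-- If `f` is constant along the edges avoiding `v` and separates the neighbours of `v`, then it
separates the branches of the graph at `v`. -/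
theorem exists_isPath_mem_support_iff (hG : G.Connected)
    (hf : ∀ a b, G.Adj a b → a ≠ v → b ≠ v → f a = f b)
    (hinj : ∀ a b, G.Adj v a → G.Adj v b → f a = f b → a = b) {s t : V} (hs : s ≠ v) (ht : t ≠ v) :
    (∃ p : G.Walk s t, p.IsPath ∧ v ∈ p.support) ↔ f s ≠ f t := by
  classical
  constructor
  · rintro ⟨p, hp, hv⟩ heq
    obtain ⟨a, ha, hva, hfa⟩ := (p.takeUntil v hv).exists_adj_of_ne hf hs
    obtain ⟨b, hb, hvb, hfb⟩ := (p.dropUntil v hv).reverse.exists_adj_of_ne hf ht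
    -- If the labels agree, both halves of the path use the same neighbour of `v`, which a path
    -- cannot visit twice.
    obtain rfl := hinj a b hva hvb (hfa.symm.trans (heq.trans hfb))
    rw [Walk.support_reverse, List.mem_reverse, Walk.mem_support_iff] at hb
    have hb' := hb.resolve_left hva.ne'
    rw [← p.take_spec hv, Walk.isPath_def, Walk.support_append] at hp
    exact (List.disjoint_of_nodup_append hp) ha hb'
  · intro h
    obtain ⟨p, hp⟩ := (hG.preconnected s t).exists_isPath
    refine ⟨p, hp, ?_⟩
    by_contra hv
    exact h (p.eq_of_notMem_support hf hv)

end SimpleGraph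

/-! ### Betweenness as the complement of a sum of squares -/

section Cost

variable {u : ℕ → ℕ} {v n m : ℕ}

/-- The vertices `m + 1 ≤ n` attached to `v`, indexed by `m`. -/
def childIndices (u : ℕ → ℕ) (v n : ℕ) : Finset ℕ := (Finset.Ico v n).filter fun m => u m = v

theorem mem_childIndices : m ∈ childIndices u v n ↔ (v ≤ m ∧ m < n) ∧ u m = v := by
  simp [childIndices]

/-- The sum of the squares of the sizes of the components of `T_n` without `v`. -/
noncomputable def branchCost (u : ℕ → ℕ) (v n : ℕ) : ℕ :=
  (n - subtreeSize u v n) ^ 2 + ∑ m ∈ childIndices u v n, subtreeSize u (m + 1) n ^ 2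

theorem Desc.child_unique {m' s : ℕ} (h1 : Desc u (m + 1) s) (h2 : Desc u (m' + 1) s)
    (hm : v ≤ m) (hm' : v ≤ m') (hu : u m = v) (hu' : u m' = v) : m = m' := by
  wlog hle : m ≤ m' generalizing m m'
  · exact (this h2 h1 hm' hm hu' hu (by omega)).symm
  rcases Desc.succ_iff.1 (h1.of_le h2 (by omega)) with h3 | ⟨_, h3⟩
  · omega
  · have := h3.le
    omega

theorem Desc.exists_child {s : ℕ} (h : Desc u v s) (hs : s ≠ v) :
    ∃ m, v ≤ m ∧ m < s ∧ u m = v ∧ Desc u (m + 1) s := by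
  induction h with
  | refl => exact absurd rfl hs
  | @step m h1 h2 ih =>
    by_cases h : u m = v
    · exact ⟨m, by omega, by omega, h, refl⟩
    · obtain ⟨k, hk1, hk2, hk3, hk4⟩ := ih h
      exact ⟨k, hk1, by omega, hk3, step h1 hk4⟩

theorem Desc.of_child {s : ℕ} (h : Desc u (m + 1) s) (hm : v ≤ m) (hu : u m = v) : Desc u v s :=
  (step (by omega) (hu ▸ refl) : Desc u v (m + 1)).trans h

theorem attachmentTree_adj_succ (hu : ValidAttachment u) {m : ℕ} (hm : 1 ≤ m) (hn : m + 1 ≤ n) :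
    (attachmentTree u n).Adj ⟨m + 1, Finset.mem_Icc.2 ⟨by omega, hn⟩⟩
      ⟨u m, Finset.mem_Icc.2 ⟨(hu m hm).1, by have := (hu m hm).2; omega⟩⟩ := by
  rw [attachmentTree, SimpleGraph.fromRel_adj]
  refine ⟨fun h => ?_, Or.inr ⟨m, hm, rfl, rfl⟩⟩
  have h1 := Subtype.mk.inj h
  have := (hu m hm).2
  omega

theorem attachmentTree_connected (hu : ValidAttachment u) (hn : 1 ≤ n) :
    (attachmentTree u n).Connected := by
  have key : ∀ s (hs : s ∈ Finset.Icc 1 n), (attachmentTree u n).Reachable ⟨s, hs⟩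
      ⟨1, Finset.mem_Icc.2 ⟨le_rfl, hn⟩⟩ := by
    intro s
    induction s using Nat.strong_induction_on with
    | _ s ih =>
      intro hs
      have hs' := Finset.mem_Icc.1 hs
      obtain ⟨m, rfl⟩ : ∃ m, s = m + 1 := ⟨s - 1, by omega⟩
      rcases Nat.eq_zero_or_pos m with rfl | hm
      · exact SimpleGraph.Reachable.refl _
      · exact (attachmentTree_adj_succ hu hm hs'.2).reachable.trans
          (ih _ (by have := (hu m hm).2; omega) _)
  have : Nonempty (Finset.Icc 1 n) := ⟨⟨1, Finset.mem_Icc.2 ⟨le_rfl, hn⟩⟩⟩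
  exact ⟨fun a b => (key a a.2).trans (key b b.2).symm⟩

/-- The index of the branch at `v` that contains `s`. -/
def branchSet (u : ℕ → ℕ) (v s : ℕ) : Set ℕ := {m | v ≤ m ∧ u m = v ∧ Desc u (m + 1) s}

theorem branchSet_eq_of_ne (hu : ValidAttachment u) (hm : 1 ≤ m) (h1 : u m ≠ v) :
    branchSet u v (u m) = branchSet u v (m + 1) := by
  ext k
  simp only [branchSet, Set.mem_ofPred_eq]
  constructor
  · rintro ⟨hk1, hk2, hk3⟩
    exact ⟨hk1, hk2, Desc.step (hu m hm).2 hk3⟩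
  · rintro ⟨hk1, hk2, hk3⟩
    rcases Desc.succ_iff.1 hk3 with h | ⟨_, h⟩
    · obtain rfl : m = k := by omega
      exact absurd hk2 h1
    · exact ⟨hk1, hk2, h⟩

theorem branchSet_of_lt {s : ℕ} (h : s ≤ v) : branchSet u v s = ∅ := by
  ext k
  simp only [branchSet, Set.mem_ofPred_eq, Set.mem_empty_iff_false, iff_false]
  rintro ⟨hk1, _, hk3⟩
  have := hk3.le
  omega

theorem mem_branchSet_self (hm : v ≤ m) (h : u m = v) : m ∈ branchSet u v (m + 1) :=
  ⟨hm, h, Desc.refl⟩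

theorem branchSet_subsingleton {s k k' : ℕ} (h : k ∈ branchSet u v s) (h' : k' ∈ branchSet u v s) :
    k = k' :=
  h.2.2.child_unique h'.2.2 h.1 h'.1 h.2.1 h'.2.1

/-- The set `branchSet u v s` serves as a branch label: empty on the root side of `v`, and the
singleton of a child index on each child branch. -/
theorem exists_path_through_iff (hu : ValidAttachment u) (v s t : Finset.Icc 1 n) (hs : s ≠ v)
    (ht : t ≠ v) : (∃ p : (attachmentTree u n).Walk s t, p.IsPath ∧ v ∈ p.support) ↔
      branchSet u v s ≠ branchSet u v t := by
  have hn : 1 ≤ n := by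
    have := Finset.mem_Icc.1 v.2
    omega
  refine SimpleGraph.exists_isPath_mem_support_iff (f := fun s : Finset.Icc 1 n => branchSet u v s)
    (attachmentTree_connected hu hn) ?_ ?_ hs ht
  · intro a b hab ha hb
    rw [attachmentTree, SimpleGraph.fromRel_adj] at hab
    obtain ⟨_, ⟨m, hm, h1, h2⟩ | ⟨m, hm, h1, h2⟩⟩ := hab
    · simp only [h1, h2]
      exact branchSet_eq_of_ne hu hm fun h => ha (Subtype.ext (h1.trans h))
    · simp only [h1, h2]
      exact (branchSet_eq_of_ne hu hm fun h => hb (Subtype.ext (h1.trans h))).symm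
  · have nbr : ∀ a : Finset.Icc 1 n, (attachmentTree u n).Adj v a →
        (∃ m, (v : ℕ) = m + 1 ∧ (a : ℕ) = u m ∧ (a : ℕ) ≤ v) ∨
        ∃ m, (v : ℕ) ≤ m ∧ u m = v ∧ (a : ℕ) = m + 1 := by
      intro a ha
      rw [attachmentTree, SimpleGraph.fromRel_adj] at ha
      obtain ⟨_, ⟨m, hm, h1, h2⟩ | ⟨m, hm, h1, h2⟩⟩ := ha
      · exact Or.inr ⟨m, by rw [h1]; exact (hu m hm).2, h1.symm, h2⟩
      · exact Or.inl ⟨m, h2, h1, by rw [h1, h2]; exact (hu m hm).2.trans (Nat.le_succ m)⟩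
    intro a b ha hb hab
    rcases nbr a ha with ⟨m, hm, hma, hav⟩ | ⟨m, hm, hmu, hma⟩ <;>
      rcases nbr b hb with ⟨k, hk, hkb, hbv⟩ | ⟨k, hk, hku, hkb⟩
    · obtain rfl : m = k := by omega
      exact Subtype.ext (hma.trans hkb.symm)
    · rw [branchSet_of_lt hav, hkb] at hab
      exact absurd (mem_branchSet_self hk hku) (by rw [← hab]; simp)
    · rw [branchSet_of_lt hbv, hma] at hab
      exact absurd (mem_branchSet_self hm hmu) (by rw [hab]; simp)
    · rw [hma, hkb] at hab
      have h1 := mem_branchSet_self hm hmu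
      rw [hab] at h1
      have := branchSet_subsingleton h1 (mem_branchSet_self hk hku)
      exact Subtype.ext (by omega)

/-- Exactly one of three things happens: `v` separates the pair, both vertices lie outside the
subtree of `v`, or both lie in the same child branch. Summing over pairs turns the last two cases
into squares. -/
theorem betweenness_pair_add (hu : ValidAttachment u) (v s t : Finset.Icc 1 n) (hs : s ≠ v)
    (ht : t ≠ v) [Decidable (∃ p : (attachmentTree u n).Walk s t, p.IsPath ∧ v ∈ p.support)] :
    (if ∃ p : (attachmentTree u n).Walk s t, p.IsPath ∧ v ∈ p.support then 1 else 0) +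
      (if Desc u v s then 0 else 1) * (if Desc u v t then 0 else 1) +
      ∑ m ∈ childIndices u v n, (if Desc u (m + 1) s then 1 else 0) *
        (if Desc u (m + 1) t then 1 else 0) = 1 := by
  have hs' : (s : ℕ) ≠ v := fun h => hs (Subtype.ext h)
  have ht' : (t : ℕ) ≠ v := fun h => ht (Subtype.ext h)
  have hempty : ∀ s : ℕ, ¬ Desc u v s → branchSet u v s = ∅ := by
    intro s h
    rw [Set.eq_empty_iff_forall_notMem]
    rintro k ⟨h1, h2, h3⟩
    exact h (h3.of_child h1 h2)
  have hzero : ∀ k ∈ childIndices u v n, ∀ s : ℕ, ¬ Desc u v s →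
      (if Desc u (k + 1) s then 1 else 0) = 0 := by
    intro k hk s h
    rw [mem_childIndices] at hk
    rw [if_neg fun h3 => h (h3.of_child hk.1.1 hk.2)]
  have hind : ∀ k ∈ childIndices u v n, ∀ (m s : ℕ), m ∈ branchSet u v s →
      (if Desc u (k + 1) s then 1 else 0) = if k = m then 1 else 0 := by
    intro k hk m s hm
    rw [mem_childIndices] at hk
    by_cases h : k = m
    · subst h
      rw [if_pos hm.2.2, if_pos rfl]
    · rw [if_neg h, if_neg fun h3 => h (branchSet_subsingleton ⟨hk.1.1, hk.2, h3⟩ hm)]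
  rw [if_congr (exists_path_through_iff hu v s t hs ht) rfl rfl]
  by_cases h1 : Desc u v s
  · obtain ⟨m, hm1, hm2, hm3, hm4⟩ := h1.exists_child hs'
    have hm : m ∈ branchSet u v s := ⟨hm1, hm3, hm4⟩
    have hmc : m ∈ childIndices u v n :=
      mem_childIndices.2 ⟨⟨hm1, by have := (Finset.mem_Icc.1 s.2).2; omega⟩, hm3⟩
    by_cases h2 : Desc u v t
    · obtain ⟨k, hk1, hk2, hk3, hk4⟩ := h2.exists_child ht'
      have hk : k ∈ branchSet u v t := ⟨hk1, hk3, hk4⟩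
      rw [Finset.sum_congr rfl fun i hi => by rw [hind i hi m s hm, hind i hi k t hk]]
      by_cases hmk : m = k
      · subst hmk
        have heq : branchSet u v s = branchSet u v t := by
          ext i
          constructor
          · intro hi
            rwa [branchSet_subsingleton hi hm]
          · intro hi
            rwa [branchSet_subsingleton hi hk]
        rw [if_neg (not_not.2 heq)]
        simp [h1, hmc]
      · have hne : branchSet u v s ≠ branchSet u v t := fun h => by
          rw [h] at hm
          exact hmk (branchSet_subsingleton hm hk)
        rw [if_pos hne]
        simp only [h1, h2, if_true, mul_zero, add_zero, ← ite_and, mul_ite, mul_one]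
        rw [Finset.sum_eq_zero fun i _ => if_neg fun h => hmk (h.2.symm.trans h.1), add_zero]
    · have hne : branchSet u v s ≠ branchSet u v t := fun h => by
        rw [h, hempty t h2] at hm
        exact hm
      rw [if_pos hne, Finset.sum_eq_zero fun i hi => by rw [hzero i hi t h2, Nat.mul_zero]]
      simp [h1]
  · rw [Finset.sum_eq_zero fun i hi => by rw [hzero i hi s h1, Nat.zero_mul], hempty s h1]
    by_cases h2 : Desc u v t
    · obtain ⟨k, hk1, hk2, hk3, hk4⟩ := h2.exists_child ht'
      have hk : k ∈ branchSet u v t := ⟨hk1, hk3, hk4⟩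
      have hne : ∅ ≠ branchSet u v t := fun h => by
        rw [← h] at hk
        exact hk
      rw [if_pos hne]
      simp [h2]
    · rw [hempty t h2]
      simp [h1, h2]

theorem betweenness_add_branchCost (hu : ValidAttachment u) (v : Finset.Icc 1 n) :
    betweenness (attachmentTree u n) v + branchCost u v n = (n - 1) ^ 2 := by
  classical
  have hv := Finset.mem_Icc.1 v.2
  set A : Finset (Finset.Icc 1 n) := Finset.univ.erase v with hA
  have hsum : ∀ g : ℕ → ℕ, ∑ s ∈ A, g s = ∑ s ∈ (Finset.Icc 1 n).erase v, g s := by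
    intro g
    have h1 : ∑ s ∈ A, g s + g v = ∑ s : Finset.Icc 1 n, g s :=
      Finset.sum_erase_add _ _ (Finset.mem_univ v)
    have h2 : ∑ s ∈ (Finset.Icc 1 n).erase v, g s + g v = ∑ s ∈ Finset.Icc 1 n, g s :=
      Finset.sum_erase_add _ _ v.2
    have h3 : ∑ s : Finset.Icc 1 n, g s = ∑ s ∈ Finset.Icc 1 n, g s :=
      Finset.sum_coe_sort (Finset.Icc 1 n) g
    omega
  have hroot : ∑ s ∈ A, (if Desc u v s then 0 else 1) = n - subtreeSize u v n := by
    rw [hsum fun s => if Desc u v s then 0 else 1]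
    have h1 : ∑ s ∈ (Finset.Icc 1 n).erase (v : ℕ), (if Desc u v s then 0 else 1) =
        ∑ s ∈ Finset.Icc 1 n, if Desc u v s then 0 else 1 :=
      Finset.sum_erase _ (by simp [Desc.refl])
    have h2 : ∑ s ∈ Finset.Icc 1 n, (if Desc u v s then 0 else 1) +
        ∑ s ∈ Finset.Icc 1 n, (if Desc u v s then 1 else 0) = n := by
      rw [← Finset.sum_add_distrib, Finset.sum_congr rfl (g := fun _ => 1)]
      · simp
      · intro s _
        split_ifs <;> rfl
    have h3 : ∑ s ∈ Finset.Icc 1 n, (if Desc u v s then 1 else 0) = subtreeSize u v n := by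
      rw [subtreeSize, Finset.card_filter]
    omega
  have hchild : ∀ m ∈ childIndices u v n,
      ∑ s ∈ A, (if Desc u (m + 1) s then 1 else 0) = subtreeSize u (m + 1) n := by
    intro m hm
    rw [mem_childIndices] at hm
    rw [hsum fun s => if Desc u (m + 1) s then 1 else 0, Finset.sum_erase, subtreeSize,
      Finset.card_filter]
    rw [if_neg]
    intro h
    have := h.le
    omega
  have h1 : ∑ s ∈ A, ∑ t ∈ A,
      ((if ∃ p : (attachmentTree u n).Walk s t, p.IsPath ∧ v ∈ p.support then 1 else 0) +
      (if Desc u v s then 0 else 1) * (if Desc u v t then 0 else 1) +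
      ∑ m ∈ childIndices u v n, (if Desc u (m + 1) s then 1 else 0) *
        (if Desc u (m + 1) t then 1 else 0)) = (n - 1) ^ 2 := by
    rw [Finset.sum_congr rfl fun s hs => Finset.sum_congr rfl fun t ht =>
      betweenness_pair_add hu v s t (Finset.ne_of_mem_erase hs) (Finset.ne_of_mem_erase ht)]
    simp [sq]
  rw [← h1, branchCost, ← add_assoc]
  simp only [Finset.sum_add_distrib]
  congr 1
  · congr 1
    · unfold betweenness
      congr!
    · rw [← hroot, sq, Finset.sum_mul_sum]
  · rw [Finset.sum_congr rfl fun s _ => Finset.sum_comm, Finset.sum_comm]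
    refine Finset.sum_congr rfl fun m hm => ?_
    rw [← hchild m hm, sq, Finset.sum_mul_sum]

theorem moreCentralAt_iff (hu : ValidAttachment u) {w : ℕ} (hv : v ∈ Finset.Icc 1 n)
    (hw : w ∈ Finset.Icc 1 n) : MoreCentralAt u n v w ↔
      branchCost u v n < branchCost u w n ∨ (branchCost u v n = branchCost u w n ∧ w < v) := by
  have h1 := betweenness_add_branchCost hu ⟨v, hv⟩
  have h2 := betweenness_add_branchCost hu ⟨w, hw⟩
  simp only at h1 h2
  rw [MoreCentralAt]
  simp only [hv, hw, exists_true_left, MoreCentral, Subtype.mk_lt_mk]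
  omega

end Cost

/-! ### Deterministic consequences of regularity -/

open Filter Topology

/-- The almost sure pathwise properties of a random recursive tree that the ranking depends on. -/
structure RegularAttachment (u : ℕ → ℕ) : Prop where
  valid : ValidAttachment u
  tendsto : ∀ v, 1 ≤ v → ∃ x : ℝ, 0 < x ∧
    Tendsto (fun n : ℕ => (subtreeSize u v n : ℝ) / n) atTop (𝓝 x)
  small : ∀ ε : ℝ, 0 < ε → ∃ V, ∀ v, V ≤ v → ∀ n, (subtreeSize u v n : ℝ) ≤ ε * n
  children : ∀ v, 1 ≤ v → ∀ N, ∃ m, N ≤ m ∧ u m = v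

section Pathwise

variable {u : ℕ → ℕ} {v w n m : ℕ}

theorem sum_subtreeSize_le {S : Finset ℕ} (hS : ∀ m ∈ S, v ≤ m ∧ u m = v) :
    ∑ m ∈ S, subtreeSize u (m + 1) n ≤ n := by
  unfold subtreeSize
  rw [← Finset.card_biUnion]
  · calc _ ≤ (Finset.Icc 1 n).card := Finset.card_le_card fun s hs => by
          rw [Finset.mem_biUnion] at hs
          obtain ⟨m, _, hs⟩ := hs
          exact (Finset.mem_filter.1 hs).1
      _ = n := by simp
  · intro m hm k hk hmk
    rw [Function.onFun, Finset.disjoint_filter]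
    intro s _ h1 h2
    exact hmk (h1.child_unique h2 (hS m hm).1 (hS k hk).1 (hS m hm).2 (hS k hk).2)

theorem subtreeSize_add_le {k : ℕ} (hm : v ≤ m ∧ u m = v) (hk : v ≤ k ∧ u k = v) (hmk : m ≠ k) :
    subtreeSize u (m + 1) n + subtreeSize u (k + 1) n ≤ n := by
  have := sum_subtreeSize_le (u := u) (v := v) (n := n) (S := {m, k}) (by
    intro i hi
    rw [Finset.mem_insert, Finset.mem_singleton] at hi
    rcases hi with rfl | rfl
    · exact hm
    · exact hk)
  rwa [Finset.sum_pair hmk] at this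

theorem sum_sq_subtreeSize_le {S : Finset ℕ} (hS : ∀ m ∈ S, v ≤ m ∧ u m = v) {c : ℝ} (hc : 0 ≤ c)
    (h : ∀ m ∈ S, (subtreeSize u (m + 1) n : ℝ) ≤ c * n) :
    ∑ m ∈ S, (subtreeSize u (m + 1) n : ℝ) ^ 2 ≤ c * n ^ 2 := by
  calc ∑ m ∈ S, (subtreeSize u (m + 1) n : ℝ) ^ 2
      ≤ ∑ m ∈ S, c * n * (subtreeSize u (m + 1) n : ℝ) := by
        refine Finset.sum_le_sum fun m hm => ?_
        rw [sq]
        exact mul_le_mul_of_nonneg_right (h m hm) (by positivity)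
    _ = c * n * ((∑ m ∈ S, subtreeSize u (m + 1) n : ℕ) : ℝ) := by
        rw [← Finset.mul_sum]
        push_cast
        rfl
    _ ≤ c * n * n := by
        refine mul_le_mul_of_nonneg_left ?_ (by positivity)
        exact_mod_cast sum_subtreeSize_le hS
    _ = c * n ^ 2 := by ring

theorem cast_branchCost : (branchCost u v n : ℝ) = ((n : ℝ) - subtreeSize u v n) ^ 2 +
    ∑ m ∈ childIndices u v n, (subtreeSize u (m + 1) n : ℝ) ^ 2 := by
  rw [branchCost]
  push_cast [Nat.cast_sub (subtreeSize_le (u := u) (v := v) (n := n))]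
  rfl

theorem cauchySeq_of_approx {f : ℕ → ℝ} (h : ∀ ε : ℝ, 0 < ε → ∃ (g : ℕ → ℝ) (L : ℝ),
    Tendsto g atTop (𝓝 L) ∧ ∀ᶠ n in atTop, |f n - g n| ≤ ε) : CauchySeq f := by
  rw [Metric.cauchySeq_iff']
  intro ε hε
  obtain ⟨g, L, hg, hfg⟩ := h (ε / 8) (by positivity)
  have h1 : ∀ᶠ n in atTop, |g n - L| < ε / 8 := by
    have := (Metric.tendsto_nhds.1 hg) (ε / 8) (by positivity)
    simpa only [Real.dist_eq] using this
  obtain ⟨N, hN⟩ := eventually_atTop.1 (h1.and hfg)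
  refine ⟨N, fun n hn => ?_⟩
  obtain ⟨a1, a2⟩ := hN n hn
  obtain ⟨b1, b2⟩ := hN N le_rfl
  rw [abs_lt] at a1 b1
  rw [abs_le] at a2 b2
  rw [Real.dist_eq, abs_lt]
  constructor <;> linarith

/-- The number of children grows with `n`, so limits cannot be taken termwise. Truncating to
children of index below `V` leaves a finite sum that converges; the other branches each have size at
most `ε * n` and total at most `n`, so they contribute at most `ε` after scaling. -/
theorem RegularAttachment.tendsto_branchCost (hu : RegularAttachment u) (hv : 1 ≤ v) :
    ∃ L : ℝ, Tendsto (fun n : ℕ => (branchCost u v n : ℝ) / (n : ℝ) ^ 2) atTop (𝓝 L) := by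
  choose! x hx0 hx using hu.tendsto
  have hroot : Tendsto (fun n : ℕ => ((n : ℝ) - subtreeSize u v n) ^ 2 / (n : ℝ) ^ 2) atTop
      (𝓝 ((1 - x v) ^ 2)) := by
    refine ((tendsto_const_nhds.sub (hx v hv)).pow 2).congr' ?_
    filter_upwards [eventually_gt_atTop 0] with n hn
    have : (n : ℝ) ≠ 0 := by positivity
    field_simp
  refine cauchySeq_tendsto_of_complete (cauchySeq_of_approx fun ε hε => ?_)
  obtain ⟨V, hV⟩ := hu.small ε hε
  refine ⟨fun n => ((n : ℝ) - subtreeSize u v n) ^ 2 / (n : ℝ) ^ 2 +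
    ∑ m ∈ childIndices u v V, ((subtreeSize u (m + 1) n : ℝ) / n) ^ 2,
    (1 - x v) ^ 2 + ∑ m ∈ childIndices u v V, x (m + 1) ^ 2,
    hroot.add (tendsto_finsetSum _ fun m _ => (hx (m + 1) (by omega)).pow 2), ?_⟩
  filter_upwards [eventually_ge_atTop (V + 1)] with n hn
  have hn0 : (0 : ℝ) < n := by
    have : 0 < n := by omega
    exact_mod_cast this
  have hsub : childIndices u v V ⊆ childIndices u v n := fun m hm => by
    rw [mem_childIndices] at hm ⊢
    omega
  have h1 : (branchCost u v n : ℝ) / (n : ℝ) ^ 2 - (((n : ℝ) - subtreeSize u v n) ^ 2 / (n : ℝ) ^ 2 +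
      ∑ m ∈ childIndices u v V, ((subtreeSize u (m + 1) n : ℝ) / n) ^ 2) =
      (∑ m ∈ childIndices u v n \ childIndices u v V, (subtreeSize u (m + 1) n : ℝ) ^ 2) / n ^ 2 := by
    rw [cast_branchCost, ← Finset.sum_sdiff hsub]
    simp only [div_pow, ← Finset.sum_div]
    ring
  have h2 := sum_sq_subtreeSize_le (u := u) (v := v) (n := n)
    (S := childIndices u v n \ childIndices u v V) (fun m hm => by
      rw [Finset.mem_sdiff, mem_childIndices] at hm
      exact ⟨hm.1.1.1, hm.1.2⟩) hε.le (fun m hm => hV _ (by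
      rw [Finset.mem_sdiff, mem_childIndices, mem_childIndices] at hm
      by_contra h
      exact hm.2 ⟨⟨hm.1.1.1, by omega⟩, hm.1.2⟩) n)
  rw [h1, abs_of_nonneg (by positivity), div_le_iff₀ (by positivity)]
  exact h2

/-- Two children of the root whose subtrees have density above `δ` force its cost to be at most `(1
- δ) * n ^ 2`. A late vertex has at least `(1 - δ / 4) * n` vertices outside its subtree, hence a
strictly larger cost. -/
theorem RegularAttachment.finite_moreCentral_root (hu : RegularAttachment u) :
    {v : ℕ | ∃ n, MoreCentralAt u n v 1}.Finite := by
  obtain ⟨c, hc1, hc⟩ := hu.children 1 le_rfl 1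
  obtain ⟨d, hd1, hd⟩ := hu.children 1 le_rfl (c + 1)
  obtain ⟨x, hx0, hx⟩ := hu.tendsto (c + 1) (by omega)
  obtain ⟨y, hy0, hy⟩ := hu.tendsto (d + 1) (by omega)
  obtain ⟨δ, hδ0, hδx, hδy, hδ1⟩ : ∃ δ : ℝ, 0 < δ ∧ δ < x ∧ δ < y ∧ δ < 1 :=
    ⟨min (min x y) 1 / 2, by positivity,
      by have := min_le_left (min x y) 1; have := min_le_left x y; linarith,
      by have := min_le_left (min x y) 1; have := min_le_right x y; linarith,
      by have := min_le_right (min x y) 1; linarith⟩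
  obtain ⟨N, hN⟩ := eventually_atTop.1 ((hx.eventually_const_lt hδx).and
    (hy.eventually_const_lt hδy))
  obtain ⟨V, hV⟩ := hu.small (δ / 4) (by positivity)
  -- Since `n ≥ v`, a bound `v ≥ N + 1` also places `n` in the range where the densities exceed `δ`.
  refine (Set.finite_lt_nat (max V (N + 1))).subset ?_
  rintro v ⟨n, hn⟩
  have hv := hn.choose
  have h1 := hn.choose_spec.choose
  rw [moreCentralAt_iff hu.valid hv h1] at hn
  rw [Finset.mem_Icc] at hv
  change v < _
  by_contra hcon
  have hVv : V ≤ v := by omega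
  have hNn : N ≤ n := by omega
  have hn0 : (0 : ℝ) < n := by
    have : 0 < n := by omega
    exact_mod_cast this
  obtain ⟨hnx, hny⟩ := hN n hNn
  rw [lt_div_iff₀ hn0] at hnx hny
  have hle : (branchCost u v n : ℝ) ≤ branchCost u 1 n := by
    have : branchCost u v n ≤ branchCost u 1 n := by omega
    exact_mod_cast this
  have hroot : (branchCost u 1 n : ℝ) ≤ (1 - δ) * n ^ 2 := by
    rw [cast_branchCost, subtreeSize_one hu.valid, sub_self]
    have := sum_sq_subtreeSize_le (u := u) (v := 1) (n := n) (S := childIndices u 1 n)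
      (fun m hm => by
        rw [mem_childIndices] at hm
        exact ⟨hm.1.1, hm.2⟩) (c := 1 - δ) (by linarith) (fun m hm => by
        rw [mem_childIndices] at hm
        -- Each branch at the root is disjoint from the subtree of `c + 1` or from that of `d + 1`.
        by_cases hmc : m = c
        · have h2 := subtreeSize_add_le (n := n) ⟨hm.1.1, hm.2⟩ (⟨by omega, hd⟩ : 1 ≤ d ∧ u d = 1)
            (by omega)
          have h3 : (subtreeSize u (m + 1) n : ℝ) + subtreeSize u (d + 1) n ≤ n := by
            exact_mod_cast h2
          linarith
        · have h2 := subtreeSize_add_le (n := n) ⟨hm.1.1, hm.2⟩ (⟨by omega, hc⟩ : 1 ≤ c ∧ u c = 1)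
            hmc
          have h3 : (subtreeSize u (m + 1) n : ℝ) + subtreeSize u (c + 1) n ≤ n := by
            exact_mod_cast h2
          linarith)
    linarith
  have hlow : ((n : ℝ) - subtreeSize u v n) ^ 2 ≤ branchCost u v n := by
    rw [cast_branchCost]
    have : 0 ≤ ∑ m ∈ childIndices u v n, (subtreeSize u (m + 1) n : ℝ) ^ 2 := by positivity
    linarith
  have hsmall := hV v hVv n
  have hbig : (1 - δ / 4) * n ≤ (n : ℝ) - subtreeSize u v n := by linarith
  have hsq : ((1 - δ / 4) * (n : ℝ)) ^ 2 ≤ ((n : ℝ) - subtreeSize u v n) ^ 2 :=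
    pow_le_pow_left₀ (mul_nonneg (by linarith) hn0.le) hbig 2
  have h2 : ((1 - δ / 4) ^ 2 - (1 - δ)) * (n : ℝ) ^ 2 ≤ 0 := by
    rw [mul_pow] at hsq
    linarith
  have h3 : 0 < (1 - δ / 4) ^ 2 - (1 - δ) := by nlinarith
  have h4 : 0 < (n : ℝ) ^ 2 := by positivity
  exact absurd h2 (not_le.2 (mul_pos h3 h4))

/-- The difference of the scaled costs of `v` and `w` vanishes in the limit. -/
def AsymptoticTie (v w : ℕ) (u : ℕ → ℕ) : Prop :=
  Tendsto (fun n : ℕ => ((branchCost u v n : ℝ) - branchCost u w n) / (n : ℝ) ^ 2) atTop (𝓝 0)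

theorem RegularAttachment.eventually_moreCentralAt (hu : RegularAttachment u) (hv : 1 ≤ v)
    (hw : 1 ≤ w) (h : ¬ AsymptoticTie v w u) :
    ∃ N, (∀ n, N ≤ n → MoreCentralAt u n v w) ∨ (∀ n, N ≤ n → MoreCentralAt u n w v) := by
  obtain ⟨L, hL⟩ := hu.tendsto_branchCost hv
  obtain ⟨M, hM⟩ := hu.tendsto_branchCost hw
  have hlt : ∀ {a b : ℕ} {A B : ℝ}, 1 ≤ a → 1 ≤ b →
      Tendsto (fun n : ℕ => (branchCost u a n : ℝ) / (n : ℝ) ^ 2) atTop (𝓝 A) →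
      Tendsto (fun n : ℕ => (branchCost u b n : ℝ) / (n : ℝ) ^ 2) atTop (𝓝 B) → A < B →
      ∃ N, ∀ n, N ≤ n → MoreCentralAt u n a b := by
    intro a b A B ha hb hA hB hAB
    obtain ⟨N, hN⟩ := eventually_atTop.1 (hA.eventually_lt hB hAB)
    refine ⟨max N (max a b), fun n hn => ?_⟩
    have hn0 : (0 : ℝ) < n := by
      have : 0 < n := by omega
      exact_mod_cast this
    have h1 := hN n (by omega)
    rw [div_lt_div_iff_of_pos_right (by positivity)] at h1
    exact (moreCentralAt_iff hu.valid (Finset.mem_Icc.2 ⟨ha, by omega⟩)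
      (Finset.mem_Icc.2 ⟨hb, by omega⟩)).2 (Or.inl (by exact_mod_cast h1))
  rcases lt_trichotomy L M with hLM | hLM | hLM
  · obtain ⟨N, hN⟩ := hlt hv hw hL hM hLM
    exact ⟨N, Or.inl hN⟩
  · refine absurd ?_ h
    have := hL.sub hM
    rw [hLM, sub_self] at this
    simpa only [AsymptoticTie, sub_div] using this
  · obtain ⟨N, hN⟩ := hlt hw hv hM hL hLM
    exact ⟨N, Or.inr hN⟩

/-- Only the finitely many competitors enter the count, so the maximum of their stabilization times
suffices. -/
theorem rootRank_eventually_const (hfin : {v : ℕ | ∃ n, MoreCentralAt u n v 1}.Finite)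
    (h : ∀ v, 1 ≤ v → v ≠ 1 → ∃ N, (∀ n, N ≤ n → MoreCentralAt u n v 1) ∨
      (∀ n, N ≤ n → MoreCentralAt u n 1 v)) :
    ∃ N, ∀ n, N ≤ n → rootRank u n = rootRank u N := by
  classical
  have hasymm : ∀ n v w, MoreCentralAt u n v w → ¬ MoreCentralAt u n w v := by
    rintro n v w ⟨hv, hw, h1⟩ ⟨_, _, h2⟩
    simp only [MoreCentral, Subtype.mk_lt_mk] at h1 h2
    omega
  have hev : ∀ v, ∃ N, ∀ n, N ≤ n → (MoreCentralAt u n v 1 ↔ MoreCentralAt u N v 1) := by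
    intro v
    by_cases hv : 1 ≤ v ∧ v ≠ 1
    · obtain ⟨N, hN | hN⟩ := h v hv.1 hv.2
      · exact ⟨N, fun n hn => iff_of_true (hN n hn) (hN N le_rfl)⟩
      · exact ⟨N, fun n hn => iff_of_false (hasymm _ _ _ (hN n hn)) (hasymm _ _ _ (hN N le_rfl))⟩
    · refine ⟨0, fun n _ => iff_of_false ?_ ?_⟩ <;> intro hc
      · rcases (by omega : v = 0 ∨ v = 1) with rfl | rfl
        · simpa using hc.choose
        · exact hasymm _ _ _ hc hc
      · rcases (by omega : v = 0 ∨ v = 1) with rfl | rfl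
        · simpa using hc.choose
        · exact hasymm _ _ _ hc hc
  choose g hg using hev
  set S := hfin.toFinset with hS
  refine ⟨S.sup g, fun n hn => ?_⟩
  have hrank : ∀ k, rootRank u k = 1 + (S.filter fun v => MoreCentralAt u k v 1).card := by
    intro k
    unfold rootRank betweennessRank
    congr 2
    ext v
    simp only [Finset.mem_filter, hS, Set.Finite.mem_toFinset]
    constructor
    · rintro ⟨_, h2⟩
      exact ⟨⟨k, h2⟩, h2⟩
    · rintro ⟨_, h2⟩
      exact ⟨h2.choose, h2⟩
  rw [hrank, hrank]
  congr 2
  refine Finset.filter_congr fun v hv => ?_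
  have h1 : g v ≤ S.sup g := Finset.le_sup hv
  rw [hg v n (h1.trans hn), hg v _ h1]

end Pathwise

/-! ### The product law and resampling of one coordinate -/

open scoped ENNReal

/-- The law of the attachment vertex `u m`: uniform on `[m]` (and concentrated at `0` for
`m = 0`). -/
noncomputable def attachmentLaw (m : ℕ) : Measure ℕ :=
  if m = 0 then Measure.dirac 0 else (m : ℝ≥0∞)⁻¹ • ∑ j ∈ Finset.Icc 1 m, Measure.dirac j

instance (m : ℕ) : IsProbabilityMeasure (attachmentLaw m) := by
  unfold attachmentLaw
  split_ifs with h
  · infer_instance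
  · constructor
    simp only [Measure.smul_apply, Measure.coe_finsetSum, Finset.sum_apply, measure_univ,
      Finset.sum_const, Nat.card_Icc, smul_eq_mul, nsmul_eq_mul, mul_one]
    rw [Nat.add_sub_cancel]
    exact ENNReal.inv_mul_cancel (by exact_mod_cast h) (ENNReal.natCast_ne_top m)

/-- The law of the attachment sequence of a uniform random recursive tree. -/
noncomputable def recursiveTreeLaw : Measure (ℕ → ℕ) := Measure.infinitePi attachmentLaw

instance : IsProbabilityMeasure recursiveTreeLaw := by
  unfold recursiveTreeLaw
  infer_instance

section Resample

variable {m n : ℕ}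

theorem lintegral_attachmentLaw (hm : 1 ≤ m) (g : ℕ → ℝ≥0∞) :
    ∫⁻ j, g j ∂attachmentLaw m = (m : ℝ≥0∞)⁻¹ * ∑ j ∈ Finset.Icc 1 m, g j := by
  rw [attachmentLaw, if_neg (by omega), lintegral_smul_measure, lintegral_finsetSum_measure,
    smul_eq_mul]
  simp

theorem integral_attachmentLaw (hm : 1 ≤ m) (g : ℕ → ℝ) :
    ∫ j, g j ∂attachmentLaw m = (m : ℝ)⁻¹ * ∑ j ∈ Finset.Icc 1 m, g j := by
  rw [attachmentLaw, if_neg (by omega), integral_smul_measure, integral_finsetSum_measure]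
  · simp
  · intro j _
    exact integrable_dirac (by simp)

theorem measurable_update_prod (m : ℕ) :
    Measurable fun p : (ℕ → ℕ) × ℕ => Function.update p.1 m p.2 := by
  rw [measurable_pi_iff]
  intro i
  by_cases h : i = m
  · subst h
    simpa using measurable_snd
  · simp only [Function.update_of_ne h]
    exact (measurable_pi_apply i).comp measurable_fst

/-- Replacing one coordinate of a product measure by an independent copy preserves the law. Both
resampling formulas below, and through them the martingale property and the tie argument, rest on
this. -/
theorem map_update_recursiveTreeLaw (m : ℕ) :
    (recursiveTreeLaw.prod (attachmentLaw m)).map (fun p => Function.update p.1 m p.2) =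
      recursiveTreeLaw := by
  refine Measure.eq_infinitePi _ fun s t ht => ?_
  rw [Measure.map_apply (measurable_update_prod m)
    (MeasurableSet.pi s.countable_toSet fun i _ => ht i)]
  by_cases hm : m ∈ s
  · have : (fun p : (ℕ → ℕ) × ℕ => Function.update p.1 m p.2) ⁻¹' (Set.pi s t) =
        (Set.pi (s.erase m : Finset ℕ) t) ×ˢ t m := by
      ext ⟨u, j⟩
      simp only [Set.mem_preimage, Set.mem_pi, Set.mem_prod, Finset.mem_coe, Finset.mem_erase]
      constructor
      · intro h
        refine ⟨fun i hi => ?_, ?_⟩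
        · simpa [Function.update_of_ne hi.1] using h i hi.2
        · simpa using h m hm
      · rintro ⟨h1, h2⟩ i hi
        by_cases him : i = m
        · subst him
          simpa using h2
        · rw [Function.update_of_ne him]
          exact h1 i ⟨him, hi⟩
    rw [this, Measure.prod_prod, recursiveTreeLaw, Measure.infinitePi_pi _ fun i _ => ht i,
      Finset.prod_erase_mul _ _ hm]
  · have : (fun p : (ℕ → ℕ) × ℕ => Function.update p.1 m p.2) ⁻¹' (Set.pi s t) =
        (Set.pi s t) ×ˢ Set.univ := by
      ext ⟨u, j⟩
      simp only [Set.mem_preimage, Set.mem_pi, Set.mem_prod, Finset.mem_coe, Set.mem_univ,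
        and_true]
      refine forall₂_congr fun i hi => ?_
      rw [Function.update_of_ne (ne_of_mem_of_not_mem hi hm)]
    rw [this, Measure.prod_prod, recursiveTreeLaw, Measure.infinitePi_pi _ fun i _ => ht i,
      measure_univ, mul_one]

theorem lintegral_resample (hm : 1 ≤ m) {F : (ℕ → ℕ) → ℝ≥0∞} (hF : Measurable F) :
    ∫⁻ u, F u ∂recursiveTreeLaw = ∫⁻ u, (m : ℝ≥0∞)⁻¹ *
      ∑ j ∈ Finset.Icc 1 m, F (Function.update u m j) ∂recursiveTreeLaw := by
  conv_lhs => rw [← map_update_recursiveTreeLaw m]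
  rw [lintegral_map hF (measurable_update_prod m),
    lintegral_prod (fun p : (ℕ → ℕ) × ℕ => F (Function.update p.1 m p.2))
      (hF.comp (measurable_update_prod m)).aemeasurable]
  simp only [lintegral_attachmentLaw hm]

theorem integral_resample (hm : 1 ≤ m) {F : (ℕ → ℕ) → ℝ} (hF : Integrable F recursiveTreeLaw) :
    ∫ u, F u ∂recursiveTreeLaw = ∫ u, (m : ℝ)⁻¹ *
      ∑ j ∈ Finset.Icc 1 m, F (Function.update u m j) ∂recursiveTreeLaw := by
  have hF' := hF
  rw [← map_update_recursiveTreeLaw m] at hF'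
  conv_lhs => rw [← map_update_recursiveTreeLaw m]
  rw [integral_map (measurable_update_prod m).aemeasurable hF'.aestronglyMeasurable,
    integral_prod (fun p : (ℕ → ℕ) × ℕ => F (Function.update p.1 m p.2))
      (hF'.comp_measurable (measurable_update_prod m))]
  simp only [integral_attachmentLaw hm]

/-- Such a function factors through finitely many natural-number coordinates, a countable space on
which every function is measurable. -/
theorem measurable_piLE_of_forall_eq {α : Type*} [MeasurableSpace α] {f : (ℕ → ℕ) → α} {n : ℕ}
    (h : ∀ u u' : ℕ → ℕ, (∀ m, m ≤ n → u m = u' m) → f u = f u') :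
    Measurable[Filtration.piLE (X := fun _ : ℕ => ℕ) n] f := by
  rw [Filtration.piLE_eq_comap_frestrictLe]
  have hf : f = (fun r : (Finset.Iic n → ℕ) =>
      f fun m => if hm : m ∈ Finset.Iic n then r ⟨m, hm⟩ else 0) ∘ Preorder.frestrictLe n := by
    ext1 u
    refine h _ _ fun m hm => ?_
    simp [hm]
  rw [hf]
  exact (measurable_of_countable _).comp (comap_measurable _)

theorem measurable_of_forall_eq {α : Type*} [MeasurableSpace α] {f : (ℕ → ℕ) → α} (n : ℕ)
    (h : ∀ u u' : ℕ → ℕ, (∀ m, m < n → u m = u' m) → f u = f u') : Measurable f :=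
  (measurable_piLE_of_forall_eq (n := n) fun u u' hu => h u u' fun m hm => hu m hm.le).mono
    (Filtration.piLE.le n) le_rfl

theorem mem_iff_of_measurableSet_piLE {A : Set (ℕ → ℕ)}
    (hA : MeasurableSet[Filtration.piLE (X := fun _ : ℕ => ℕ) n] A) {u u' : ℕ → ℕ}
    (hu : ∀ m, m ≤ n → u m = u' m) : u ∈ A ↔ u' ∈ A := by
  rw [Filtration.piLE_eq_comap_frestrictLe] at hA
  obtain ⟨B, _, rfl⟩ := hA
  have : Preorder.frestrictLe n u = Preorder.frestrictLe (π := fun _ : ℕ => ℕ) n u' := by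
    ext ⟨i, hi⟩
    exact hu i (Finset.mem_Iic.1 hi)
  rw [Set.mem_preimage, Set.mem_preimage, this]

theorem measurable_subtreeSize (v n : ℕ) : Measurable fun u => subtreeSize u v n :=
  measurable_of_forall_eq n fun _ _ hu => subtreeSize_congr hu

end Resample

/-! ### Urn martingales -/

section Martingale

variable {v : ℕ}

/-- The filtration of the trees `T_v, T_{v+1}, …`. -/
def treeFiltration (v : ℕ) : Filtration ℕ (MeasurableSpace.pi : MeasurableSpace (ℕ → ℕ)) where
  -- The tree `T_n` reads only `u m` with `m < n`, so time `k`, meaning `T_(v + k)`, sees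
  -- coordinates up to `v + k - 1`.
  seq k := Filtration.piLE (X := fun _ : ℕ => ℕ) (v + k - 1)
  mono' _ _ h := Filtration.piLE.mono (by omega)
  le' _ := Filtration.piLE.le _

theorem sum_ite_desc (u : ℕ → ℕ) (v n : ℕ) (a b : ℝ) :
    ∑ j ∈ Finset.Icc 1 n, (if Desc u v j then a else b) =
      subtreeSize u v n * a + (n - subtreeSize u v n) * b := by
  have h := Finset.card_filter_add_card_filter_not (s := Finset.Icc 1 n) (Desc u v)
  rw [Nat.card_Icc, Nat.add_sub_cancel] at h
  have h' : ((Finset.filter (fun j => ¬ Desc u v j) (Finset.Icc 1 n)).card : ℝ) =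
      n - subtreeSize u v n := by
    rw [eq_sub_iff_add_eq', subtreeSize]
    exact_mod_cast h
  rw [Finset.sum_ite, Finset.sum_const, Finset.sum_const, nsmul_eq_mul, nsmul_eq_mul, h',
    subtreeSize]

theorem subtreeSize_update_succ {u : ℕ → ℕ} {n j : ℕ} (hn : v ≤ n) (hj : j ≤ n) :
    subtreeSize (Function.update u n j) v (n + 1) =
      subtreeSize u v n + if Desc u v j then 1 else 0 := by
  have h1 : Desc (Function.update u n j) v j ↔ Desc u v j := by
    constructor <;> intro h <;> refine h.congr fun i hi => ?_ <;>
      rw [Function.update_of_ne (by omega)]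
  rw [subtreeSize_succ (by simpa using hj) hn, Function.update_self,
    subtreeSize_congr (u' := u) fun i hi => Function.update_of_ne (by omega) _ _]
  simp only [h1]

/-- The subtree of `v` grows as a Pólya urn: from size `d` in `T_n` it gains a vertex with
probability `d / n`. The hypothesis is the resulting one-step harmonicity of `h`. -/
theorem martingale_subtreeSize (hv : 1 ≤ v) (h : ℕ → ℕ → ℝ)
    (hh : ∀ n d, v ≤ n → d ≤ n →
      (n : ℝ) * h n d = d * h (n + 1) (d + 1) + (n - d) * h (n + 1) d) :
    Martingale (fun k u => h (v + k) (subtreeSize u v (v + k))) (treeFiltration v)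
      recursiveTreeLaw := by
  have hmeas : ∀ n, Measurable fun u => h n (subtreeSize u v n) := fun n =>
    (measurable_of_countable (h n)).comp (measurable_subtreeSize v n)
  have hint : ∀ n, Integrable (fun u => h n (subtreeSize u v n)) recursiveTreeLaw := by
    intro n
    refine Integrable.of_bound (hmeas n).aestronglyMeasurable
      (∑ d ∈ Finset.range (n + 1), |h n d|) (ae_of_all _ fun u => ?_)
    rw [Real.norm_eq_abs]
    exact Finset.single_le_sum (f := fun d => |h n d|) (fun d _ => abs_nonneg _)
      (Finset.mem_range.2 (Nat.lt_succ_of_le subtreeSize_le))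
  refine martingale_of_setIntegral_eq_succ (fun k => ?_) (fun k => hint _) fun k A hA => ?_
  · refine Measurable.stronglyMeasurable (measurable_piLE_of_forall_eq fun u u' hu => ?_)
    rw [subtreeSize_congr fun m hm => hu m (by omega)]
  · have hA' : MeasurableSet A := (treeFiltration v).le k A hA
    rw [← integral_indicator hA', ← integral_indicator hA',
      integral_resample (m := v + k) (by omega) ((hint (v + (k + 1))).indicator hA')]
    congr 1
    ext1 u
    have hn0 : ((v + k : ℕ) : ℝ) ≠ 0 := by
      have : v + k ≠ 0 := by omega
      exact_mod_cast this
    -- The past event `A` ignores the resampled coordinate, so averaging over that coordinate acts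
    -- as the conditional expectation.
    have hmem : ∀ j, Function.update u (v + k) j ∈ A ↔ u ∈ A := fun j =>
      mem_iff_of_measurableSet_piLE hA fun m hm => Function.update_of_ne (by omega) _ _
    by_cases hu : u ∈ A
    · rw [Set.indicator_of_mem hu, eq_inv_mul_iff_mul_eq₀ hn0,
        hh _ _ (Nat.le_add_right v k) subtreeSize_le, ← sum_ite_desc]
      refine Finset.sum_congr rfl fun j hj => ?_
      rw [Set.indicator_of_mem ((hmem j).2 hu), ← add_assoc,
        subtreeSize_update_succ (Nat.le_add_right v k) (Finset.mem_Icc.1 hj).2]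
      split_ifs <;> rfl
    · rw [Set.indicator_of_notMem hu, Finset.sum_eq_zero, mul_zero]
      intro j _
      rw [Set.indicator_of_notMem (mt (hmem j).1 hu)]

theorem ae_tendsto_subtreeSize (hv : 1 ≤ v) : ∀ᵐ u ∂recursiveTreeLaw, ∃ x : ℝ,
    Tendsto (fun n : ℕ => (subtreeSize u v n : ℝ) / n) atTop (𝓝 x) := by
  have hM := martingale_subtreeSize hv (fun n d => (d : ℝ) / n) (by
    intro n d hn hd
    have : (n : ℝ) ≠ 0 := by
      have : n ≠ 0 := by omega
      exact_mod_cast this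
    have : (n : ℝ) + 1 ≠ 0 := by positivity
    push_cast
    field_simp
    ring)
  have hb := hM.submartingale.ae_tendsto_limitProcess (R := 1) (by
    intro k
    refine (eLpNorm_le_of_ae_bound (C := 1) (ae_of_all _ fun u => ?_)).trans (by simp)
    rw [Real.norm_of_nonneg (by positivity)]
    refine div_le_one_of_le₀ ?_ (by positivity)
    exact_mod_cast subtreeSize_le)
  filter_upwards [hb] with u hu
  simp only [add_comm v] at hu
  exact ⟨_, (tendsto_add_atTop_iff_nat (f := fun n : ℕ => (subtreeSize u v n : ℝ) / n) v).1 hu⟩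

/-- Doob's maximal inequality for the quadratic martingale `d (d + 1) / (n (n + 1))`, which starts
at `2 / (v (v + 1))`. The linear martingale would give only order `1 / v`, which is not summable in
`v`. -/
theorem measure_exists_lt_subtreeSize_le (hv : 1 ≤ v) {ε : ℝ} (hε : 0 < ε) :
    recursiveTreeLaw {u | ∃ n : ℕ, ε * n < subtreeSize u v n} ≤
      ENNReal.ofReal (2 / ε ^ 2 * (1 / (v : ℝ) ^ 2)) := by
  have hv0 : (0 : ℝ) < v := by exact_mod_cast hv
  set h : ℕ → ℕ → ℝ := fun n d => (d : ℝ) * (d + 1) / (n * (n + 1)) with hh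
  have hM := martingale_subtreeSize hv h (by
    intro n d hn hd
    have : (n : ℝ) ≠ 0 := by
      have : n ≠ 0 := by omega
      exact_mod_cast this
    have : (n : ℝ) + 1 ≠ 0 := by positivity
    have : (n : ℝ) + 1 + 1 ≠ 0 := by positivity
    simp only [hh]
    push_cast
    field_simp
    ring)
  have hnn : (0 : ℕ → (ℕ → ℕ) → ℝ) ≤ fun k u => h (v + k) (subtreeSize u v (v + k)) := by
    intro k u
    simp only [hh]
    positivity
  set S : ℕ → Set (ℕ → ℕ) := fun K => {u | ((ε ^ 2).toNNReal : ℝ) ≤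
    (Finset.range (K + 1)).sup' Finset.nonempty_range_add_one
      fun k => h (v + k) (subtreeSize u v (v + k))} with hS
  have hbound : ∀ K, recursiveTreeLaw (S K) ≤ ENNReal.ofReal (2 / ε ^ 2 * (1 / (v : ℝ) ^ 2)) := by
    intro K
    have h1 := maximal_ineq hM.submartingale hnn (ε := (ε ^ 2).toNNReal) K
    have h2 : ∫ u in S K, h (v + K) (subtreeSize u v (v + K)) ∂recursiveTreeLaw ≤ 2 / v ^ 2 := by
      calc _ ≤ ∫ u, h (v + K) (subtreeSize u v (v + K)) ∂recursiveTreeLaw :=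
            setIntegral_le_integral (hM.integrable K) (ae_of_all _ (hnn K))
        _ = ∫ u, h (v + 0) (subtreeSize u v (v + 0)) ∂recursiveTreeLaw := by
            rw [← setIntegral_univ, ← setIntegral_univ (f := fun u => h (v + 0) _)]
            exact (hM.setIntegral_eq (Nat.zero_le K) MeasurableSet.univ).symm
        _ ≤ 2 / v ^ 2 := by
            simp only [add_zero, subtreeSize_self hv, hh, integral_const, probReal_univ, one_smul,
              Nat.cast_one]
            rw [div_le_div_iff₀ (by positivity) (by positivity)]
            nlinarith
    have h3 : ENNReal.ofReal (ε ^ 2) * recursiveTreeLaw (S K) ≤ ENNReal.ofReal (2 / v ^ 2) :=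
      h1.trans (ENNReal.ofReal_le_ofReal h2)
    have h4 : ENNReal.ofReal (ε ^ 2) ≠ 0 := by
      rw [Ne, ENNReal.ofReal_eq_zero, not_le]
      positivity
    rw [mul_comm, ← ENNReal.le_div_iff_mul_le (Or.inl h4) (Or.inl ENNReal.ofReal_ne_top),
      ← ENNReal.ofReal_div_of_pos (by positivity)] at h3
    refine h3.trans (le_of_eq ?_)
    congr 1
    field_simp
  have hmono : Monotone S := by
    intro K K' hK u hu
    exact le_trans (Set.mem_ofPred_eq ▸ hu) (Finset.sup'_mono _ (Finset.range_mono (Nat.succ_le_succ hK)) _)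
  have hsub : {u | ∃ n : ℕ, ε * n < subtreeSize u v n} ⊆ ⋃ K, S K := by
    rintro u ⟨n, hn⟩
    have hvn : v ≤ n := by
      by_contra hlt
      rw [subtreeSize_eq_zero (by omega)] at hn
      have : 0 ≤ ε * n := by positivity
      norm_num at hn
      linarith
    obtain ⟨k, rfl⟩ := Nat.exists_eq_add_of_le hvn
    refine Set.mem_iUnion.2 ⟨k, ?_⟩
    rw [hS, Set.mem_ofPred_eq, Real.coe_toNNReal _ (by positivity), Finset.le_sup'_iff]
    refine ⟨k, Finset.self_mem_range_succ k, ?_⟩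
    simp only [hh]
    have hle : (subtreeSize u v (v + k) : ℝ) ≤ (v + k : ℕ) := by exact_mod_cast subtreeSize_le
    have hn0 : (0 : ℝ) < (v + k : ℕ) := by
      have : 0 < v + k := by omega
      exact_mod_cast this
    -- Exceeding `ε * n` with a size at most `n` forces `ε ≤ 1`, which absorbs the shift by one in
    -- the second factor.
    have hε1 : ε * ((v + k : ℕ) + 1) ≤ subtreeSize u v (v + k) + 1 := by
      have : ε ≤ 1 := by
        by_contra hlt
        nlinarith
      nlinarith
    rw [le_div_iff₀ (by positivity)]
    calc ε ^ 2 * (((v + k : ℕ) : ℝ) * ((v + k : ℕ) + 1))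
        = (ε * (v + k : ℕ)) * (ε * ((v + k : ℕ) + 1)) := by ring
      _ ≤ _ := mul_le_mul hn.le hε1 (by positivity) (by positivity)
  refine (measure_mono hsub).trans ?_
  rw [hmono.measure_iUnion]
  exact iSup_le hbound

theorem ae_small_subtreeSize : ∀ᵐ u ∂recursiveTreeLaw, ∀ ε : ℝ, 0 < ε → ∃ V, ∀ v, V ≤ v →
    ∀ n, (subtreeSize u v n : ℝ) ≤ ε * n := by
  have h1 : ∀ i : ℕ, ∀ᵐ u ∂recursiveTreeLaw, ∀ᶠ v in atTop,
      u ∉ {u | ∃ n : ℕ, (1 / ((i : ℝ) + 1)) * n < subtreeSize u (v + 1) n} := by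
    intro i
    refine ae_eventually_notMem (ne_top_of_le_ne_top ?_ (ENNReal.tsum_le_tsum fun v =>
      measure_exists_lt_subtreeSize_le (Nat.le_add_left 1 v) (by positivity)))
    have hs : Summable fun v : ℕ => 2 / (1 / ((i : ℝ) + 1)) ^ 2 * (1 / ((v + 1 : ℕ) : ℝ) ^ 2) :=
      ((summable_nat_add_iff 1).2 (Real.summable_one_div_nat_pow.2 one_lt_two)).mul_left _
    rw [← ENNReal.ofReal_tsum_of_nonneg (fun v => by positivity) hs]
    exact ENNReal.ofReal_ne_top
  filter_upwards [ae_all_iff.2 h1] with u hu ε hε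
  obtain ⟨i, hi⟩ := exists_nat_one_div_lt hε
  obtain ⟨V, hV⟩ := eventually_atTop.1 (hu i)
  refine ⟨V + 1, fun v hv n => ?_⟩
  have h2 := hV (v - 1) (by omega)
  rw [Nat.sub_add_cancel (by omega)] at h2
  simp only [not_exists, not_lt] at h2
  exact (h2 n).trans (mul_le_mul_of_nonneg_right hi.le (by positivity))

end Martingale

/-! ### Almost sure regularity -/

section Regularity

variable {v n : ℕ}

theorem attachmentLaw_singleton {m : ℕ} (hv : 1 ≤ v) (hm : v ≤ m) :
    attachmentLaw m {v} = (m : ℝ≥0∞)⁻¹ := by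
  rw [← lintegral_indicator_one (measurableSet_singleton v), lintegral_attachmentLaw (by omega),
    Finset.sum_eq_single v]
  · simp
  · intro j _ hj
    simp [hj]
  · intro h
    exact absurd (Finset.mem_Icc.2 ⟨hv, hm⟩) h

theorem ae_validAttachment : ∀ᵐ u ∂recursiveTreeLaw, ValidAttachment u := by
  refine ae_all_iff.2 fun m => ?_
  by_cases hm : 1 ≤ m
  · have h1 : ∀ᵐ j ∂attachmentLaw m, 1 ≤ j ∧ j ≤ m := by
      have h2 : MeasurableSet {j | ¬ (1 ≤ j ∧ j ≤ m)} := MeasurableSet.of_discrete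
      rw [ae_iff, ← lintegral_indicator_one h2, lintegral_attachmentLaw hm,
        Finset.sum_eq_zero, mul_zero]
      intro j hj
      rw [Finset.mem_Icc] at hj
      rw [Set.indicator_of_notMem]
      exact fun h => h hj
    filter_upwards [(measurePreserving_eval_infinitePi attachmentLaw
      m).quasiMeasurePreserving.ae h1] with u hu _ using hu
  · exact ae_of_all _ fun u h => absurd h hm

/-- The events `u m = v` are independent with probabilities `1 / m` for `m ≥ v`, and the harmonic
series diverges. -/
theorem ae_exists_child (hv : 1 ≤ v) :
    ∀ᵐ u ∂recursiveTreeLaw, ∀ N, ∃ m, N ≤ m ∧ u m = v := by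
  set s : ℕ → Set (ℕ → ℕ) := fun m => {u | u m = v} with hs
  have hpre : ∀ m, s m = (fun u : ℕ → ℕ => u m) ⁻¹' {v} := fun m => rfl
  have hsm : ∀ m, MeasurableSet (s m) := fun m => by
    rw [hpre]
    exact measurable_pi_apply m (measurableSet_singleton v)
  have hμ : ∀ m, recursiveTreeLaw (s m) = attachmentLaw m {v} := fun m => by
    rw [hpre]
    exact (measurePreserving_eval_infinitePi attachmentLaw m).measure_preimage
      (measurableSet_singleton v).nullMeasurableSet
  have hindep : iIndepSet s recursiveTreeLaw := by
    rw [iIndepSet_iff_meas_biInter hsm]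
    intro t
    simp only [hμ]
    rw [recursiveTreeLaw, ← Measure.infinitePi_pi attachmentLaw
      fun i _ => measurableSet_singleton v]
    congr 1
    ext u
    simp [hs, Set.mem_pi]
  have hsum : ∑' m, recursiveTreeLaw (s m) = ∞ := by
    by_contra h
    have h1 := (summable_nat_add_iff v).2 (ENNReal.summable_toReal h)
    refine Real.not_summable_natCast_inv ((summable_nat_add_iff v).1 (h1.congr fun m => ?_))
    rw [hμ, attachmentLaw_singleton hv (Nat.le_add_left v m), ENNReal.toReal_inv,
      ENNReal.toReal_natCast]
  have h1 := measure_limsup_eq_one hsm hindep hsum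
  have h2 : ∀ᵐ u ∂recursiveTreeLaw, u ∈ limsup s atTop :=
    (prob_compl_eq_zero_iff (MeasurableSet.measurableSet_limsup hsm)).2 h1
  filter_upwards [h2] with u hu N
  rw [mem_limsup_iff_frequently_mem, frequently_atTop] at hu
  exact hu N

theorem integral_subtreeSize_succ (hv : 1 ≤ v) (hn : v ≤ n) (g : ℕ → ℝ) :
    n * ∫ u, g (subtreeSize u v (n + 1)) ∂recursiveTreeLaw =
      ∫ u, (subtreeSize u v n * g (subtreeSize u v n + 1) +
        (n - subtreeSize u v n) * g (subtreeSize u v n)) ∂recursiveTreeLaw := by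
  have hint : Integrable (fun u => g (subtreeSize u v (n + 1))) recursiveTreeLaw := by
    refine Integrable.of_bound ((measurable_of_countable g).comp
      (measurable_subtreeSize v (n + 1))).aestronglyMeasurable
      (∑ d ∈ Finset.range (n + 2), |g d|) (ae_of_all _ fun u => ?_)
    rw [Real.norm_eq_abs]
    exact Finset.single_le_sum (f := fun d => |g d|) (fun d _ => abs_nonneg _)
      (Finset.mem_range.2 (Nat.lt_succ_of_le subtreeSize_le))
  have hn0 : (n : ℝ) ≠ 0 := by
    have : n ≠ 0 := by omega
    exact_mod_cast this
  rw [integral_resample (m := n) (by omega) hint, integral_const_mul, mul_inv_cancel_left₀ hn0]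
  congr 1
  ext1 u
  rw [← sum_ite_desc]
  refine Finset.sum_congr rfl fun j hj => ?_
  rw [subtreeSize_update_succ hn (Finset.mem_Icc.1 hj).2]
  split_ifs <;> rfl

theorem measureReal_eq_integral_ite (v n k : ℕ) :
    recursiveTreeLaw.real {u | subtreeSize u v n = k} =
      ∫ u, (if subtreeSize u v n = k then (1 : ℝ) else 0) ∂recursiveTreeLaw := by
  have h : MeasurableSet {u | subtreeSize u v n = k} :=
    measurable_subtreeSize v n (measurableSet_singleton k)
  rw [← integral_indicator_one h]
  congr 1
  ext1 u
  rw [Set.indicator_apply]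
  rfl

/-- The subtree sizes are not concentrated: no value has probability above `(v - 1) / (n - 1)`. -/
theorem measureReal_subtreeSize_eq_le (hv : 2 ≤ v) (hn : v ≤ n) (k : ℕ) :
    ((n : ℝ) - 1) * recursiveTreeLaw.real {u | subtreeSize u v n = k} ≤ (v : ℝ) - 1 := by
  have hv2 : (2 : ℝ) ≤ v := by exact_mod_cast hv
  induction n, hn using Nat.le_induction generalizing k with
  | base =>
    calc _ ≤ ((v : ℝ) - 1) * 1 :=
          mul_le_mul_of_nonneg_left measureReal_le_one (by linarith)
      _ = _ := mul_one _
  | succ n hn ih =>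
    have hn2 : (2 : ℝ) ≤ n := by
      have : 2 ≤ n := by omega
      exact_mod_cast this
    have hzero : ∀ j, (∀ u, subtreeSize u v (n + 1) ≠ j) →
        (((n + 1 : ℕ) : ℝ) - 1) * recursiveTreeLaw.real {u | subtreeSize u v (n + 1) = j} ≤
          (v : ℝ) - 1 := by
      intro j hj
      have : {u | subtreeSize u v (n + 1) = j} = ∅ := Set.eq_empty_of_forall_notMem hj
      rw [this, measureReal_empty, mul_zero]
      linarith
    rcases k with _ | k
    · refine hzero 0 fun u h => ?_
      have := subtreeSize_pos (u := u) (by omega : 1 ≤ v) (by omega : v ≤ n + 1)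
      omega
    · by_cases hk : n < k + 1
      · refine hzero _ fun u h => ?_
        have := subtreeSize_lt (u := u) hv (by omega : 1 ≤ n + 1)
        omega
      -- The coefficients `k` and `n - (k + 1)` sum to `n - 1`, which is exactly what carries the
      -- bound from `n` to `n + 1`.
      · have hrec : (n : ℝ) * recursiveTreeLaw.real {u | subtreeSize u v (n + 1) = k + 1} =
            k * recursiveTreeLaw.real {u | subtreeSize u v n = k} +
            (n - (k + 1)) * recursiveTreeLaw.real {u | subtreeSize u v n = k + 1} := by
          have hi : ∀ j, Integrable (fun u => if subtreeSize u v n = j then (1 : ℝ) else 0)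
              recursiveTreeLaw := fun j => by
            refine Integrable.of_bound ((measurable_of_countable
              fun d : ℕ => if d = j then (1 : ℝ) else 0).comp
              (measurable_subtreeSize v n)).aestronglyMeasurable 1 (ae_of_all _ fun u => ?_)
            split_ifs <;> simp
          rw [measureReal_eq_integral_ite, measureReal_eq_integral_ite,
            measureReal_eq_integral_ite,
            integral_subtreeSize_succ (by omega) hn fun d => if d = k + 1 then (1 : ℝ) else 0,
            ← integral_const_mul, ← integral_const_mul,
            ← integral_add ((hi k).const_mul _) ((hi (k + 1)).const_mul _)]
          congr 1
          ext1 u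
          congr 1
          · by_cases h : subtreeSize u v n = k
            · simp [h]
            · simp [h]
          · by_cases h : subtreeSize u v n = k + 1
            · simp [h]
            · simp [h]
        have hk1 : (k : ℝ) + 1 ≤ n := by exact_mod_cast not_lt.1 hk
        have h1 := mul_le_mul_of_nonneg_left (ih k) (Nat.cast_nonneg (α := ℝ) k)
        have h2 := mul_le_mul_of_nonneg_left (ih (k + 1)) (by linarith : (0 : ℝ) ≤ n - (k + 1))
        have h3 : ((n : ℝ) - 1) *
            (n * recursiveTreeLaw.real {u | subtreeSize u v (n + 1) = k + 1}) ≤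
            ((n : ℝ) - 1) * (v - 1) := by
          rw [hrec]
          linarith
        have h4 := le_of_mul_le_mul_left h3 (by linarith)
        push_cast
        rwa [add_sub_cancel_right]

/-- At most `ε * n` positive values are available, each of probability at most `(v - 1) / (n - 1)`.
The bound is uniform in `n`, so it rules out an atom of the limit at zero. -/
theorem measureReal_subtreeSize_le_mul (hv : 2 ≤ v) (hn : v ≤ n) {ε : ℝ} (hε : 0 ≤ ε) :
    recursiveTreeLaw.real {u | (subtreeSize u v n : ℝ) ≤ ε * n} ≤ 2 * ε * v := by
  have hn2 : (2 : ℝ) ≤ n := by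
    have : 2 ≤ n := by omega
    exact_mod_cast this
  have hsub : {u | (subtreeSize u v n : ℝ) ≤ ε * n} ⊆
      ⋃ k ∈ Finset.Icc 1 ⌊ε * n⌋₊, {u | subtreeSize u v n = k} := by
    intro u hu
    simp only [Set.mem_iUnion]
    exact ⟨_, Finset.mem_Icc.2 ⟨subtreeSize_pos (by omega) hn, Nat.le_floor hu⟩, rfl⟩
  have hle : ∀ k ∈ Finset.Icc 1 ⌊ε * n⌋₊,
      recursiveTreeLaw.real {u | subtreeSize u v n = k} ≤ ((v : ℝ) - 1) / (n - 1) := by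
    intro k _
    rw [le_div_iff₀' (by linarith)]
    exact measureReal_subtreeSize_eq_le hv hn k
  have hv2 : (2 : ℝ) ≤ v := by exact_mod_cast hv
  calc _ ≤ recursiveTreeLaw.real (⋃ k ∈ Finset.Icc 1 ⌊ε * n⌋₊, {u | subtreeSize u v n = k}) :=
        measureReal_mono hsub (measure_ne_top _ _)
    _ ≤ ∑ k ∈ Finset.Icc 1 ⌊ε * n⌋₊, recursiveTreeLaw.real {u | subtreeSize u v n = k} :=
        measureReal_biUnion_finset_le _ _
    _ ≤ ∑ k ∈ Finset.Icc 1 ⌊ε * n⌋₊, ((v : ℝ) - 1) / (n - 1) := Finset.sum_le_sum hle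
    _ = ⌊ε * n⌋₊ * (((v : ℝ) - 1) / (n - 1)) := by simp
    _ ≤ ε * n * (v / (n / 2)) := by
        refine mul_le_mul (Nat.floor_le (by positivity)) ?_
          (div_nonneg (by linarith) (by linarith)) (by positivity)
        exact div_le_div₀ (by linarith) (by linarith) (by linarith) (by linarith)
    _ = 2 * ε * v := by
        field_simp

theorem ae_not_tendsto_zero (hv : 2 ≤ v) : ∀ᵐ u ∂recursiveTreeLaw,
    ¬ Tendsto (fun n : ℕ => (subtreeSize u v n : ℝ) / n) atTop (𝓝 0) := by
  have hle : ∀ ε : ℝ, 0 < ε → recursiveTreeLaw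
      {u | Tendsto (fun n : ℕ => (subtreeSize u v n : ℝ) / n) atTop (𝓝 0)} ≤
      ENNReal.ofReal (2 * ε * v) := by
    intro ε hε
    set S : ℕ → Set (ℕ → ℕ) := fun N => {u | ∀ n, N ≤ n → (subtreeSize u v n : ℝ) ≤ ε * n}
    have hmono : Monotone S := fun N N' h u hu n hn => hu n (h.trans hn)
    have hsub : {u | Tendsto (fun n : ℕ => (subtreeSize u v n : ℝ) / n) atTop (𝓝 0)} ⊆
        ⋃ N, S N := by
      intro u hu
      obtain ⟨N, hN⟩ := eventually_atTop.1
        ((Tendsto.eventually_lt_const hε hu).and (eventually_gt_atTop 0))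
      refine Set.mem_iUnion.2 ⟨N, fun n hn => ?_⟩
      obtain ⟨h1, h2⟩ := hN n hn
      rw [div_lt_iff₀ (by exact_mod_cast h2)] at h1
      exact h1.le
    refine (measure_mono hsub).trans ?_
    rw [hmono.measure_iUnion]
    refine iSup_le fun N => ?_
    calc recursiveTreeLaw (S N) ≤ recursiveTreeLaw
          {u | (subtreeSize u v (max N v) : ℝ) ≤ ε * (max N v : ℕ)} :=
          measure_mono fun u hu => hu _ (le_max_left _ _)
      _ = ENNReal.ofReal (recursiveTreeLaw.real
          {u | (subtreeSize u v (max N v) : ℝ) ≤ ε * (max N v : ℕ)}) := by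
          rw [ofReal_measureReal]
      _ ≤ _ := ENNReal.ofReal_le_ofReal
          (measureReal_subtreeSize_le_mul hv (le_max_right _ _) hε.le)
  rw [ae_iff]
  simp only [not_not]
  have hlim : Tendsto (fun ε : ℝ => ENNReal.ofReal (2 * ε * v)) (𝓝[>] 0) (𝓝 0) := by
    have h1 : Tendsto (fun ε : ℝ => ENNReal.ofReal (2 * ε * v)) (𝓝 0)
        (𝓝 (ENNReal.ofReal (2 * 0 * v))) :=
      (ENNReal.continuous_ofReal.comp (by fun_prop)).tendsto 0
    simp only [mul_zero, zero_mul, ENNReal.ofReal_zero] at h1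
    exact h1.mono_left nhdsWithin_le_nhds
  exact le_antisymm (ge_of_tendsto hlim (eventually_mem_nhdsWithin.mono fun ε hε => hle ε hε)) zero_le

theorem ae_tendsto_subtreeSize_pos (hv : 1 ≤ v) : ∀ᵐ u ∂recursiveTreeLaw, ∃ x : ℝ, 0 < x ∧
    Tendsto (fun n : ℕ => (subtreeSize u v n : ℝ) / n) atTop (𝓝 x) := by
  have hpos : ∀ᵐ u ∂recursiveTreeLaw,
      ¬ Tendsto (fun n : ℕ => (subtreeSize u v n : ℝ) / n) atTop (𝓝 0) := by
    rcases hv.eq_or_lt with rfl | hv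
    · filter_upwards [ae_validAttachment] with u hu h
      refine one_ne_zero (tendsto_nhds_unique (tendsto_const_nhds.congr' ?_) h)
      filter_upwards [eventually_gt_atTop 0] with n hn
      rw [subtreeSize_one hu, div_self (by positivity)]
    · exact ae_not_tendsto_zero hv
  filter_upwards [hpos, ae_tendsto_subtreeSize hv] with u h1 h2
  obtain ⟨x, hx⟩ := h2
  refine ⟨x, lt_of_le_of_ne (ge_of_tendsto' hx fun n => by positivity) ?_, hx⟩
  rintro rfl
  exact h1 hx

theorem ae_regularAttachment : ∀ᵐ u ∂recursiveTreeLaw, RegularAttachment u := by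
  have h1 : ∀ᵐ u ∂recursiveTreeLaw, ∀ v, 1 ≤ v → ∃ x : ℝ, 0 < x ∧
      Tendsto (fun n : ℕ => (subtreeSize u v n : ℝ) / n) atTop (𝓝 x) := by
    refine ae_all_iff.2 fun v => ?_
    by_cases hv : 1 ≤ v
    · filter_upwards [ae_tendsto_subtreeSize_pos hv] with u hu _ using hu
    · exact ae_of_all _ fun u h => absurd h hv
  have h2 : ∀ᵐ u ∂recursiveTreeLaw, ∀ v, 1 ≤ v → ∀ N, ∃ m, N ≤ m ∧ u m = v := by
    refine ae_all_iff.2 fun v => ?_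
    by_cases hv : 1 ≤ v
    · filter_upwards [ae_exists_child hv] with u hu _ using hu
    · exact ae_of_all _ fun u h => absurd h hv
  filter_upwards [ae_validAttachment, h1, ae_small_subtreeSize, h2] with u a b c d
  exact ⟨a, b, c, d⟩

end Regularity

/-! ### Asymptotic ties are null -/

section Tie

variable {u : ℕ → ℕ} {v w n m : ℕ}

theorem branchCost_congr {u' : ℕ → ℕ} (hu : ∀ m, m < n → u m = u' m) :
    branchCost u v n = branchCost u' v n := by
  have h1 : childIndices u v n = childIndices u' v n := by
    ext m
    simp only [mem_childIndices]
    constructor <;> rintro ⟨h1, h2⟩ <;> exact ⟨h1, by rw [← h2, hu m h1.2]⟩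
  rw [branchCost, branchCost, h1, subtreeSize_congr hu]
  simp only [subtreeSize_congr hu]

theorem measurableSet_asymptoticTie (v w : ℕ) : MeasurableSet {u | AsymptoticTie v w u} := by
  refine measurableSet_tendsto (𝓝 0) fun n => measurable_of_forall_eq n fun u u' hu => ?_
  rw [branchCost_congr hu, branchCost_congr hu]

theorem Desc.iff_of_le {a b j : ℕ} (h : Desc u b j) (hab : a ≤ b) : Desc u a j ↔ Desc u a b :=
  ⟨fun h' => h'.of_le h hab, fun h' => h'.trans h⟩

/-- Moving the subtree of `m + 1` between two branches at `w` does not change the branches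
at `v`. -/
theorem branchCost_update_eq {c c' j j' : ℕ} (hv : 1 ≤ v) (hvw : v < w) (hc : w ≤ c ∧ u c = w)
    (hc' : w ≤ c' ∧ u c' = w) (hj : j ≤ m) (hj' : j' ≤ m)
    (hcj : Desc u (c + 1) j) (hcj' : Desc u (c' + 1) j') :
    branchCost (Function.update u m j) v n = branchCost (Function.update u m j') v n := by
  have hwj : Desc u w j := hcj.of_child hc.1 hc.2
  have hwj' : Desc u w j' := hcj'.of_child hc'.1 hc'.2
  have hlow : ∀ a, a ≤ w → (Desc u a j ↔ Desc u a j') := fun a ha =>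
    (hwj.iff_of_le ha).trans (hwj'.iff_of_le ha).symm
  have hwle := hwj.le
  have hwle' := hwj'.le
  have hsize : ∀ a, 1 ≤ a → (Desc u a j ↔ Desc u a j') →
      subtreeSize (Function.update u m j) a n = subtreeSize (Function.update u m j') a n := by
    intro a ha h
    by_cases ham : a ≤ m
    · simp only [subtreeSize_update ha ham hj, subtreeSize_update ha ham hj', h]
    · rw [subtreeSize_update_of_lt (by omega), subtreeSize_update_of_lt (by omega)]
  have hchild : childIndices (Function.update u m j) v n =
      childIndices (Function.update u m j') v n := by
    ext k
    simp only [mem_childIndices]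
    by_cases hk : k = m
    · subst hk
      simp only [Function.update_self]
      omega
    · simp only [Function.update_of_ne hk]
  -- A child of `v` with label above `w` is not an ancestor of anything strictly below `w`: by the
  -- chain property it would have to lie on the path between `w` and its descendant, which forces
  -- its parent to be at least `w`.
  have hbranch : ∀ {b i k : ℕ}, w ≤ b → u b = w → Desc u (b + 1) i → w < k + 1 → v ≤ k →
      u k = v → ¬ Desc u (k + 1) i := by
    intro b i k hb hub hbi hwk hvk huk h
    rcases le_total (k + 1) (b + 1) with hle | hle
    · rcases Desc.succ_iff.1 (h.of_le hbi hle) with h1 | ⟨_, h1⟩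
      · obtain rfl : b = k := by omega
        omega
      · have := h1.le
        omega
    · rcases Desc.succ_iff.1 (hbi.of_le h hle) with h1 | ⟨_, h1⟩
      · obtain rfl : b = k := by omega
        omega
      · have := h1.le
        omega
  rw [branchCost, branchCost, hchild, hsize v hv (hlow v hvw.le)]
  congr 1
  refine Finset.sum_congr rfl fun k hk => ?_
  rw [mem_childIndices] at hk
  have hkm : k ≠ m := by
    rintro rfl
    rw [Function.update_self] at hk
    omega
  rw [Function.update_of_ne hkm] at hk
  rw [hsize (k + 1) (by omega)]
  by_cases hkw : k + 1 ≤ w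
  · exact hlow _ hkw
  · exact iff_of_false (hbranch hc.1 hc.2 hcj (by omega) hk.1.1 hk.2)
      (hbranch hc'.1 hc'.2 hcj' (by omega) hk.1.1 hk.2)

/-- The effect on `w` of moving the subtree of `m + 1` between two branches at `w`. -/
theorem branchCost_update_sub {c c' j j' : ℕ} (hw : 1 ≤ w) (hc : w ≤ c ∧ u c = w)
    (hc' : w ≤ c' ∧ u c' = w) (hcc : c ≠ c') (hcm : c < m) (hcm' : c' < m) (hj : j ≤ m)
    (hj' : j' ≤ m) (hcj : Desc u (c + 1) j) (hcj' : Desc u (c' + 1) j') (hn : m ≤ n) :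
    (branchCost (Function.update u m j) w n : ℝ) - branchCost (Function.update u m j') w n =
      2 * subtreeSize u (m + 1) n * ((subtreeSize (Function.update u m 0) (c + 1) n : ℝ) -
        subtreeSize (Function.update u m 0) (c' + 1) n) := by
  have hwj : Desc u w j := hcj.of_child hc.1 hc.2
  have hwj' : Desc u w j' := hcj'.of_child hc'.1 hc'.2
  have hle := hcj.le
  have hle' := hcj'.le
  have hnot : ¬ Desc u (c' + 1) j := fun h => hcc (hcj.child_unique h hc.1 hc'.1 hc.2 hc'.2)
  have hnot' : ¬ Desc u (c + 1) j' := fun h => hcc (h.child_unique hcj' hc.1 hc'.1 hc.2 hc'.2)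
  have hchild : childIndices (Function.update u m j) w n =
      childIndices (Function.update u m j') w n := by
    ext k
    simp only [mem_childIndices]
    by_cases hk : k = m
    · subst hk
      simp only [Function.update_self]
      omega
    · simp only [Function.update_of_ne hk]
  have hroot : subtreeSize (Function.update u m j) w n =
      subtreeSize (Function.update u m j') w n := by
    rw [subtreeSize_update hw (by omega) hj, subtreeSize_update hw (by omega) hj', if_pos hwj,
      if_pos hwj']
  rw [cast_branchCost, cast_branchCost, hchild, hroot, add_sub_add_left_eq_sub,
    ← Finset.sum_sub_distrib]
  rw [Finset.sum_eq_add_of_mem c c'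
    (mem_childIndices.2 ⟨⟨hc.1, by omega⟩, by rw [Function.update_of_ne hcm.ne, hc.2]⟩)
    (mem_childIndices.2 ⟨⟨hc'.1, by omega⟩, by rw [Function.update_of_ne hcm'.ne, hc'.2]⟩) hcc]
  · rw [subtreeSize_update (by omega) (by omega) hj, subtreeSize_update (by omega) (by omega) hj',
      subtreeSize_update (by omega) (by omega) hj, subtreeSize_update (by omega) (by omega) hj',
      if_pos hcj, if_pos hcj', if_neg hnot, if_neg hnot']
    push_cast
    ring
  -- Child branches other than those of `c` and `c'` contain neither new parent, so their sizes
  -- cancel.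
  · rintro k hk ⟨hkc, hkc'⟩
    rw [mem_childIndices] at hk
    have hkm : k ≠ m := by
      rintro rfl
      rw [Function.update_self] at hk
      omega
    rw [Function.update_of_ne hkm] at hk
    rw [sub_eq_zero]
    by_cases h : k + 1 ≤ m
    · rw [subtreeSize_update (by omega) h hj, subtreeSize_update (by omega) h hj', if_neg, if_neg]
      · exact fun h => hkc' (h.child_unique hcj' hk.1.1 hc'.1 hk.2 hc'.2)
      · exact fun h => hkc (h.child_unique hcj hk.1.1 hc.1 hk.2 hc.2)
    · rw [subtreeSize_update_of_lt (by omega), subtreeSize_update_of_lt (by omega)]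

/-- The cost of `v` is the same in both trees, so two ties would make the two costs of `w` agree to
order `n ^ 2`. They differ by twice the size of the moved subtree times the size gap of the
receiving branches, which is at least `2 * y * η * n ^ 2` asymptotically. -/
theorem not_asymptoticTie_both {c c' j j' : ℕ} (hu : ValidAttachment u) (hv : 1 ≤ v) (hvw : v < w)
    (hc : w ≤ c ∧ u c = w) (hc' : w ≤ c' ∧ u c' = w) (hcc : c ≠ c') (hcm : c < m) (hcm' : c' < m)
    (hj : j ≤ m) (hj' : j' ≤ m) (hcj : Desc u (c + 1) j) (hcj' : Desc u (c' + 1) j')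
    {y η : ℝ} (hy : 0 < y) (hη : 0 < η)
    (hlim : Tendsto (fun n : ℕ => (subtreeSize u (m + 1) n : ℝ) / n) atTop (𝓝 y))
    (hgap : ∀ᶠ n : ℕ in atTop, η * n ≤ (subtreeSize u (c + 1) n : ℝ) - subtreeSize u (m + 1) n -
      subtreeSize u (c' + 1) n) :
    ¬ (AsymptoticTie v w (Function.update u m j) ∧ AsymptoticTie v w (Function.update u m j')) := by
  rintro ⟨h1, h2⟩
  have h3 := h2.sub h1
  rw [sub_zero] at h3
  have h4 : Tendsto (fun n : ℕ => 2 * ((subtreeSize u (m + 1) n : ℝ) / n) * η) atTop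
      (𝓝 (2 * y * η)) := (hlim.const_mul 2).mul_const η
  have h5 : 2 * y * η ≤ 0 := by
    refine le_of_tendsto_of_tendsto h4 h3 ?_
    filter_upwards [hgap, eventually_ge_atTop (m + 1)] with n hn hmn
    have hn0 : (0 : ℝ) < n := by
      have : 0 < n := by omega
      exact_mod_cast this
    rw [← sub_div, branchCost_update_eq hv hvw hc hc' hj hj' hcj hcj', sub_sub_sub_cancel_left,
      branchCost_update_sub (by omega) hc hc' hcc hcm hcm' hj hj' hcj hcj' (by omega),
      le_div_iff₀ (by positivity)]
    have hum := (hu m (by omega)).2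
    -- In `u` itself `m + 1` may already hang below `c + 1`; subtracting its size in `hgap` covers
    -- that case.
    have e1 : subtreeSize u (c + 1) n ≤
        subtreeSize (Function.update u m 0) (c + 1) n + subtreeSize u (m + 1) n := by
      have := subtreeSize_update (u := u) (n := n) (by omega : 1 ≤ c + 1) (by omega) hum
      rw [Function.update_eq_self] at this
      rw [this]
      split_ifs <;> omega
    have e2 : subtreeSize (Function.update u m 0) (c' + 1) n ≤ subtreeSize u (c' + 1) n := by
      have := subtreeSize_update (u := u) (n := n) (by omega : 1 ≤ c' + 1) (by omega) hum
      rw [Function.update_eq_self] at this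
      omega
    have e1' : (subtreeSize u (c + 1) n : ℝ) ≤
        subtreeSize (Function.update u m 0) (c + 1) n + subtreeSize u (m + 1) n := by
      exact_mod_cast e1
    have e2' : (subtreeSize (Function.update u m 0) (c' + 1) n : ℝ) ≤ subtreeSize u (c' + 1) n := by
      exact_mod_cast e2
    calc 2 * ((subtreeSize u (m + 1) n : ℝ) / n) * η * (n : ℝ) ^ 2
        = 2 * subtreeSize u (m + 1) n * (η * n) := by
          field_simp
      _ ≤ _ := mul_le_mul_of_nonneg_left (by linarith) (by positivity)
  have h6 : 0 < 2 * y * η := by positivity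
  linarith

/-- Resampling a late coordinate rarely leaves a given event. -/
theorem tendsto_lintegral_resample_compl {E : Set (ℕ → ℕ)} (hE : MeasurableSet E) :
    Tendsto (fun m : ℕ => ∫⁻ u, E.indicator (fun u => (m : ℝ≥0∞)⁻¹ *
      ∑ j ∈ Finset.Icc 1 m, Eᶜ.indicator 1 (Function.update u m j)) u ∂recursiveTreeLaw)
      atTop (𝓝 0) := by
  rw [ENNReal.tendsto_nhds_zero]
  intro ε hε
  -- A cylinder `C` close to `E` is unaffected by coordinates beyond its base. Leaving `E` then
  -- requires starting in `E \ C` or landing in `C \ E`, and resampling preserves the measure of the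
  -- latter.
  obtain ⟨C, hC, hCE⟩ := exists_measure_symmDiff_lt_of_generateFrom_isSetRing
    (μ := recursiveTreeLaw) isSetRing_measurableCylinders
    ⟨{Set.univ}, Set.countable_singleton _, Set.singleton_subset_iff.2
      (univ_mem_measurableCylinders fun _ : ℕ => ℕ), by simp⟩
    generateFrom_measurableCylinders.symm hE (ENNReal.half_pos hε.ne')
  rw [mem_measurableCylinders] at hC
  obtain ⟨s, S, hS, rfl⟩ := hC
  have hCm : MeasurableSet (cylinder s S) := MeasurableSet.cylinder (α := fun _ : ℕ => ℕ) s hS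
  set C := cylinder (α := fun _ : ℕ => ℕ) s S with hCdef
  filter_upwards [eventually_gt_atTop (s.sup id)] with m hm
  have hm1 : 1 ≤ m := by omega
  have hmC : ∀ u j, Function.update u m j ∈ C ↔ u ∈ C := by
    intro u j
    rw [hCdef, mem_cylinder, mem_cylinder]
    have : s.restrict (Function.update u m j) = s.restrict (π := fun _ => ℕ) u := by
      ext ⟨i, hi⟩
      refine Function.update_of_ne ?_ _ _
      have : i ≤ s.sup id := Finset.le_sup (f := id) hi
      exact (this.trans_lt hm).ne
    rw [this]
  have hm0 : (m : ℝ≥0∞) ≠ 0 := by exact_mod_cast (by omega : m ≠ 0)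
  have hone : ∀ (A : Set (ℕ → ℕ)) u, A.indicator (1 : (ℕ → ℕ) → ℝ≥0∞) u ≤ 1 := fun A u =>
    Set.indicator_le_self' (f := (1 : (ℕ → ℕ) → ℝ≥0∞)) (fun _ _ => zero_le) u
  have hpt : ∀ u, E.indicator (fun u => (m : ℝ≥0∞)⁻¹ *
      ∑ j ∈ Finset.Icc 1 m, Eᶜ.indicator 1 (Function.update u m j)) u ≤
      (E \ C).indicator 1 u + (m : ℝ≥0∞)⁻¹ *
        ∑ j ∈ Finset.Icc 1 m, (C \ E).indicator 1 (Function.update u m j) := by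
    intro u
    by_cases hu : u ∈ E
    · rw [Set.indicator_of_mem hu]
      by_cases huC : u ∈ C
      · refine le_add_left (mul_le_mul_right (Finset.sum_le_sum fun j _ => ?_) _)
        by_cases hj : Function.update u m j ∈ E
        · rw [Set.indicator_of_notMem (not_not.2 hj)]
          exact zero_le
        · rw [Set.indicator_of_mem (show Function.update u m j ∈ C \ E from
            ⟨(hmC u j).2 huC, hj⟩)]
          exact hone _ _
      · rw [Set.indicator_of_mem (show u ∈ E \ C from ⟨hu, huC⟩)]
        refine le_add_right ?_
        calc (m : ℝ≥0∞)⁻¹ * ∑ j ∈ Finset.Icc 1 m, Eᶜ.indicator 1 (Function.update u m j)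
            ≤ (m : ℝ≥0∞)⁻¹ * ∑ j ∈ Finset.Icc 1 m, 1 :=
              mul_le_mul_right (Finset.sum_le_sum fun j _ => hone _ _) _
          _ = 1 := by
              simp [ENNReal.inv_mul_cancel hm0 (ENNReal.natCast_ne_top m)]
    · rw [Set.indicator_of_notMem hu]
      exact zero_le
  have hmeas : Measurable ((C \ E).indicator (1 : (ℕ → ℕ) → ℝ≥0∞)) :=
    measurable_one.indicator (hCm.diff hE)
  calc _ ≤ ∫⁻ u, ((E \ C).indicator 1 u + (m : ℝ≥0∞)⁻¹ *
        ∑ j ∈ Finset.Icc 1 m, (C \ E).indicator 1 (Function.update u m j)) ∂recursiveTreeLaw :=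
        lintegral_mono hpt
    _ = recursiveTreeLaw (E \ C) + recursiveTreeLaw (C \ E) := by
        rw [lintegral_add_left (measurable_one.indicator (hE.diff hCm)),
          ← lintegral_resample hm1 hmeas, lintegral_indicator_one (hE.diff hCm),
          lintegral_indicator_one (hCm.diff hE)]
    _ ≤ ε / 2 + ε / 2 := by
        refine add_le_add ((measure_mono ?_).trans hCE.le) ((measure_mono ?_).trans hCE.le)
        · exact Set.subset_union_right
        · exact Set.subset_union_left
    _ = ε := ENNReal.add_halves ε

/-- An event that is destroyed by a positive proportion of the resamplings of every late
coordinate is null. -/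
theorem measure_eq_zero_of_resample {E A : Set (ℕ → ℕ)} (hE : MeasurableSet E) (hAE : A ⊆ E)
    {δ : ℝ≥0∞} (hδ : δ ≠ 0) (hA : ∀ u ∈ A, ∀ᶠ m : ℕ in atTop, δ ≤ (m : ℝ≥0∞)⁻¹ *
      ∑ j ∈ Finset.Icc 1 m, Eᶜ.indicator 1 (Function.update u m j)) :
    recursiveTreeLaw A = 0 := by
  set F : ℕ → (ℕ → ℕ) → ℝ≥0∞ := fun m u => E.indicator (fun u => (m : ℝ≥0∞)⁻¹ *
      ∑ j ∈ Finset.Icc 1 m, Eᶜ.indicator 1 (Function.update u m j)) u with hF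
  have hFm : ∀ m, Measurable (F m) := fun m => by
    refine Measurable.indicator (Measurable.const_mul
      (Finset.measurable_fun_sum _ fun j _ => ?_) _) hE
    refine (measurable_one.indicator hE.compl).comp ?_
    exact (measurable_update_prod m).comp (measurable_id.prodMk measurable_const)
  set B : ℕ → Set (ℕ → ℕ) := fun N => {u | ∀ m, N ≤ m → δ ≤ F m u}
  have hsub : A ⊆ ⋃ N, B N := by
    intro u hu
    obtain ⟨N, hN⟩ := eventually_atTop.1 (hA u hu)
    refine Set.mem_iUnion.2 ⟨N, fun m hm => ?_⟩
    simp only [hF, Set.indicator_of_mem (hAE hu)]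
    exact hN m hm
  have hB : ∀ N, recursiveTreeLaw (B N) = 0 := by
    intro N
    have h1 : ∀ᶠ m in atTop, δ * recursiveTreeLaw (B N) ≤ ∫⁻ u, F m u ∂recursiveTreeLaw := by
      filter_upwards [eventually_ge_atTop N] with m hm
      calc δ * recursiveTreeLaw (B N) ≤ δ * recursiveTreeLaw {u | δ ≤ F m u} :=
            mul_le_mul_right (measure_mono fun u (hu : ∀ m, N ≤ m → δ ≤ F m u) => hu m hm) _
        _ ≤ _ := mul_meas_ge_le_lintegral (hFm m) δ
    have h2 := ge_of_tendsto (tendsto_lintegral_resample_compl hE) h1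
    exact (mul_eq_zero.1 (le_antisymm h2 zero_le)).resolve_left hδ
  exact measure_mono_null hsub (measure_iUnion_null hB)

theorem le_sum_indicator_of_desc {E : Set (ℕ → ℕ)} {a : ℕ} {δ : ℝ} (hm : 1 ≤ m)
    (hδ : δ * m ≤ subtreeSize u a m)
    (h : ∀ j, j ≤ m → Desc u a j → Function.update u m j ∉ E) :
    ENNReal.ofReal δ ≤ (m : ℝ≥0∞)⁻¹ *
      ∑ j ∈ Finset.Icc 1 m, Eᶜ.indicator 1 (Function.update u m j) := by
  have hm0 : (m : ℝ≥0∞) ≠ 0 := by exact_mod_cast (by omega : m ≠ 0)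
  rw [mul_comm, ← div_eq_mul_inv,
    ENNReal.le_div_iff_mul_le (Or.inl hm0) (Or.inl (ENNReal.natCast_ne_top m))]
  calc ENNReal.ofReal δ * m = ENNReal.ofReal (δ * m) := by
        rw [ENNReal.ofReal_mul' (Nat.cast_nonneg m), ENNReal.ofReal_natCast]
    _ ≤ ENNReal.ofReal (subtreeSize u a m) := ENNReal.ofReal_le_ofReal hδ
    _ = subtreeSize u a m := ENNReal.ofReal_natCast _
    _ = ∑ j ∈ (Finset.Icc 1 m).filter (Desc u a), 1 := by simp [subtreeSize]
    _ ≤ ∑ j ∈ (Finset.Icc 1 m).filter (Desc u a), Eᶜ.indicator 1 (Function.update u m j) := by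
        refine Finset.sum_le_sum fun j hj => ?_
        rw [Finset.mem_filter, Finset.mem_Icc] at hj
        rw [Set.indicator_of_mem (show Function.update u m j ∈ Eᶜ from h j hj.1.2 hj.2)]
        rfl
    _ ≤ _ := Finset.sum_le_sum_of_subset (Finset.filter_subset _ _)

/-- Either every new parent below `c + 1` destroys the tie, or one of them keeps it and then every
new parent below `c' + 1` destroys it. Both sets of parents have positive density in `[m]`. -/
theorem RegularAttachment.exists_eventually_le_resample (hu : RegularAttachment u) (hv : 1 ≤ v)
    (hvw : v < w) : ∃ i : ℕ, ∀ᶠ m : ℕ in atTop, ENNReal.ofReal (1 / ((i : ℝ) + 1)) ≤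
      (m : ℝ≥0∞)⁻¹ * ∑ j ∈ Finset.Icc 1 m,
        {u | AsymptoticTie v w u}ᶜ.indicator 1 (Function.update u m j) := by
  obtain ⟨c, hcw, hc⟩ := hu.children w (by omega) w
  obtain ⟨x, hx0, hx⟩ := hu.tendsto (c + 1) (by omega)
  obtain ⟨V, hV⟩ := hu.small (x / 4) (by positivity)
  -- Choosing `c'` and later `m` beyond `V` makes both subtrees at most `x / 4` of the tree, while
  -- `c + 1` eventually exceeds `3 / 4 * x`; the gap left is `x / 4`.
  obtain ⟨c', hcw', hc'⟩ := hu.children w (by omega) (max V (c + 1))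
  obtain ⟨x', hx0', hx'⟩ := hu.tendsto (c' + 1) (by omega)
  have hww : w ≤ c' := by omega
  obtain ⟨i, hi⟩ := exists_nat_one_div_lt (lt_min hx0 hx0')
  refine ⟨i, ?_⟩
  filter_upwards [hx.eventually_const_lt (hi.trans_le (min_le_left _ _)),
    hx'.eventually_const_lt (hi.trans_le (min_le_right _ _)),
    eventually_ge_atTop (max V (c' + 1))] with m h1 h2 hm
  have hm0 : (0 : ℝ) < m := by
    have : 0 < m := by omega
    exact_mod_cast this
  rw [lt_div_iff₀ hm0] at h1 h2
  obtain ⟨y, hy0, hy⟩ := hu.tendsto (m + 1) (by omega)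
  have hgap : ∀ᶠ n : ℕ in atTop, x / 4 * n ≤ (subtreeSize u (c + 1) n : ℝ) -
      subtreeSize u (m + 1) n - subtreeSize u (c' + 1) n := by
    filter_upwards [hx.eventually_const_lt (by linarith : 3 / 4 * x < x),
      eventually_gt_atTop 0] with n hn hn0
    rw [lt_div_iff₀ (by exact_mod_cast hn0)] at hn
    have e1 := hV (m + 1) (by omega) n
    have e2 := hV (c' + 1) (by omega) n
    linarith
  by_cases hall : ∀ j, j ≤ m → Desc u (c + 1) j →
      Function.update u m j ∉ {u | AsymptoticTie v w u}
  · exact le_sum_indicator_of_desc (by omega) h1.le hall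
  · push Not at hall
    obtain ⟨j, hjm, hcj, hj⟩ := hall
    refine le_sum_indicator_of_desc (by omega) h2.le fun j' hjm' hcj' hj' => ?_
    exact not_asymptoticTie_both hu.valid hv hvw ⟨hcw, hc⟩ ⟨hww, hc'⟩ (by omega) (by omega)
      (by omega) hjm hjm' hcj hcj' hy0 (by positivity) hy hgap ⟨hj, hj'⟩

theorem ae_not_asymptoticTie (hv : 1 ≤ v) (hvw : v < w) :
    ∀ᵐ u ∂recursiveTreeLaw, ¬ AsymptoticTie v w u := by
  have h1 : ∀ i : ℕ, ∀ᵐ u ∂recursiveTreeLaw, u ∉ {u | AsymptoticTie v w u ∧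
      ∀ᶠ m : ℕ in atTop, ENNReal.ofReal (1 / ((i : ℝ) + 1)) ≤
      (m : ℝ≥0∞)⁻¹ * ∑ j ∈ Finset.Icc 1 m,
        {u | AsymptoticTie v w u}ᶜ.indicator 1 (Function.update u m j)} := by
    intro i
    refine measure_eq_zero_iff_ae_notMem.1 (measure_eq_zero_of_resample
      (measurableSet_asymptoticTie v w) (fun u hu => hu.1) ?_ fun u hu => hu.2)
    rw [Ne, ENNReal.ofReal_eq_zero, not_le]
    positivity
  filter_upwards [ae_all_iff.2 h1, ae_regularAttachment] with u hu hreg htie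
  obtain ⟨i, hi⟩ := hreg.exists_eventually_le_resample hv hvw
  exact hu i ⟨htie, hi⟩

end Tie

/-! ### Transfer to an arbitrary probability space -/

theorem attachmentTree_congr {u u' : ℕ → ℕ} {n : ℕ} (h : ∀ m, 1 ≤ m → m < n → u m = u' m) :
    attachmentTree u n = attachmentTree u' n := by
  unfold attachmentTree
  congr 1
  ext i j
  have hj := (Finset.mem_Icc.1 j.2).2
  constructor <;> rintro ⟨m, hm, h1, h2⟩
  · exact ⟨m, hm, by rw [h1, h m hm (by omega)], h2⟩
  · exact ⟨m, hm, by rw [h1, h m hm (by omega)], h2⟩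

theorem moreCentralAt_congr {u u' : ℕ → ℕ} {n : ℕ} (h : ∀ m, 1 ≤ m → m < n → u m = u' m)
    (v w : ℕ) : MoreCentralAt u n v w ↔ MoreCentralAt u' n v w := by
  unfold MoreCentralAt
  rw [attachmentTree_congr h]

theorem rootRank_congr {u u' : ℕ → ℕ} {n : ℕ} (h : ∀ m, 1 ≤ m → m < n → u m = u' m) :
    rootRank u n = rootRank u' n := by
  classical
  unfold rootRank betweennessRank
  congr 2
  exact Finset.filter_congr fun v _ => moreCentralAt_congr h v 1

theorem measurable_rootRank (n : ℕ) : Measurable fun u => rootRank u n :=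
  measurable_of_forall_eq n fun _ _ hu => rootRank_congr fun m _ hm => hu m hm

section Transfer

variable {Ω : Type*} [MeasurableSpace Ω] {μ : Measure Ω}

/-- A sequence of measurable `ℕ`-valued variables that is almost surely eventually constant is
persistent. -/
theorem persistent_of_ae_eventually_const {X : ℕ → Ω → ℕ} (hX : ∀ n, Measurable (X n))
    (h : ∀ᵐ ω ∂μ, ∃ N, ∀ n, N ≤ n → X n ω = X N ω) : Persistent μ X := by
  classical
  have hS : ∀ k, MeasurableSet {ω | ∀ n, k ≤ n → X n ω = X k ω} := fun k => by
    have : {ω | ∀ n, k ≤ n → X n ω = X k ω} = ⋂ n, ⋂ _ : k ≤ n, {ω | X n ω = X k ω} := by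
      ext ω
      simp
    rw [this]
    exact MeasurableSet.iInter fun n => MeasurableSet.iInter fun _ =>
      measurableSet_eq_fun (hX n) (hX k)
  -- The second alternative makes the search total, so `Nat.find` is defined and measurable off the
  -- good event too.
  have hex : ∀ ω, ∃ k, (∀ n, k ≤ n → X n ω = X k ω) ∨
      ¬ ∃ N, ∀ n, N ≤ n → X n ω = X N ω := by
    intro ω
    by_cases hω : ∃ N, ∀ n, N ≤ n → X n ω = X N ω
    · obtain ⟨N, hN⟩ := hω
      exact ⟨N, Or.inl hN⟩
    · exact ⟨0, Or.inr hω⟩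
  have hN : Measurable fun ω => Nat.find (hex ω) := by
    refine measurable_find hex fun k => (hS k).union (MeasurableSet.compl ?_)
    have : {ω | ∃ N, ∀ n, N ≤ n → X n ω = X N ω} =
        ⋃ N, {ω | ∀ n, N ≤ n → X n ω = X N ω} := by
      ext ω
      simp
    have hU := MeasurableSet.iUnion hS
    rwa [← this] at hU
  have hK : Measurable fun ω => X (Nat.find (hex ω)) ω :=
    (measurable_from_prod_countable_right (f := fun p : ℕ × Ω => X p.1 p.2) hX).comp
      (hN.prodMk measurable_id)
  refine ⟨_, _, hN, hK, ?_⟩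
  filter_upwards [h] with ω hω n hn
  rcases Nat.find_spec (hex ω) with h1 | h1
  · exact h1 n hn
  · exact absurd hω h1

/-- The attachment sequence with its irrelevant value at `0` normalized. -/
def normalizedAttachment (U : ℕ → Ω → ℕ) (ω : Ω) (m : ℕ) : ℕ := if m = 0 then 0 else U m ω

theorem measurable_normalizedAttachment {U : ℕ → Ω → ℕ} (hU : IsUniformAttachment μ U) :
    Measurable (normalizedAttachment U) := by
  rw [measurable_pi_iff]
  intro m
  unfold normalizedAttachment
  by_cases hm : m = 0
  · simp [hm]
  · simpa [hm] using hU.measurable m (by omega)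

/-- The prescribed point masses show only that the uniform law is dominated by the law of `U m`; two
probability measures so ordered coincide. -/
theorem map_attachment_eq [IsProbabilityMeasure μ] {U : ℕ → Ω → ℕ} (hU : IsUniformAttachment μ U)
    {m : ℕ} (hm : 1 ≤ m) : μ.map (U m) = attachmentLaw m := by
  have hmeas := hU.measurable m hm
  have hprob : IsProbabilityMeasure (μ.map (U m)) :=
    Measure.isProbabilityMeasure_map hmeas.aemeasurable
  have hle : attachmentLaw m ≤ μ.map (U m) := by
    rw [Measure.le_iff]
    intro s hs
    rw [← lintegral_indicator_one hs, lintegral_attachmentLaw hm, Finset.mul_sum]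
    calc ∑ j ∈ Finset.Icc 1 m, (m : ℝ≥0∞)⁻¹ * s.indicator 1 j
        = ∑ j ∈ Finset.Icc 1 m, (μ.map (U m)) {j} * s.indicator 1 j := by
          refine Finset.sum_congr rfl fun j hj => ?_
          rw [Measure.map_apply hmeas (measurableSet_singleton j)]
          exact congrArg (· * s.indicator 1 j) (hU.uniform m hm j hj).symm
      _ ≤ ∑' j, (μ.map (U m)) {j} * s.indicator 1 j := ENNReal.sum_le_tsum _
      _ = ∫⁻ j, s.indicator 1 j ∂(μ.map (U m)) := by
          rw [lintegral_countable']
          simp only [mul_comm]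
      _ = (μ.map (U m)) s := lintegral_indicator_one hs
  exact (Measure.eq_of_le_of_isProbabilityMeasure hle).symm

theorem map_normalizedAttachment [IsProbabilityMeasure μ] {U : ℕ → Ω → ℕ}
    (hU : IsUniformAttachment μ U) : μ.map (normalizedAttachment U) = recursiveTreeLaw := by
  refine Measure.eq_infinitePi _ fun s t ht => ?_
  rw [Measure.map_apply (measurable_normalizedAttachment hU)
    (MeasurableSet.pi s.countable_toSet fun i _ => ht i)]
  have hpos : ∀ m, 1 ≤ m → μ (U m ⁻¹' t m) = attachmentLaw m (t m) := fun m hm => by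
    rw [← map_attachment_eq hU hm, Measure.map_apply (hU.measurable m hm) (ht m)]
  have hind : μ (⋂ i ∈ s.erase 0, U i ⁻¹' t i) = ∏ i ∈ s.erase 0, attachmentLaw i (t i) := by
    -- Independence is assumed for the shifted family `U (n + 1)`, so the nonzero indices are
    -- rewritten as successors.
    have hset : s.erase 0 = ((s.erase 0).image Nat.pred).map (addRightEmbedding 1) := by
      ext i
      simp only [Finset.mem_map, Finset.mem_image, addRightEmbedding_apply]
      constructor
      · intro hi
        have := Finset.ne_of_mem_erase hi
        exact ⟨_, ⟨i, hi, rfl⟩, Nat.succ_pred this⟩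
      · rintro ⟨_, ⟨i, hi, rfl⟩, rfl⟩
        rwa [← Nat.succ_eq_add_one, Nat.succ_pred (Finset.ne_of_mem_erase hi)]
    rw [hset, Finset.prod_map]
    have := hU.indep.measure_inter_preimage_eq_mul ((s.erase 0).image Nat.pred)
      (sets := fun i => t (i + 1)) fun i _ => ht (i + 1)
    rw [Finset.prod_congr rfl fun i _ => hpos (i + 1) (by omega)] at this
    refine Eq.trans ?_ this
    congr 1
    ext ω
    simp
  by_cases h0 : 0 ∈ s
  · rw [← Finset.mul_prod_erase _ _ h0, ← hind]
    by_cases h0t : 0 ∈ t 0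
    · rw [attachmentLaw, if_pos rfl, Measure.dirac_apply_of_mem h0t, one_mul]
      congr 1
      ext ω
      simp only [Set.mem_preimage, Set.mem_pi, Finset.mem_coe, Set.mem_iInter, Finset.mem_erase]
      constructor
      · intro h i hi
        simpa [normalizedAttachment, hi.1] using h i hi.2
      · intro h i hi
        by_cases hi0 : i = 0
        · subst hi0
          simpa [normalizedAttachment] using h0t
        · simpa [normalizedAttachment, hi0] using h i ⟨hi0, hi⟩
    · rw [attachmentLaw, if_pos rfl, Measure.dirac_apply' _ (ht 0),
        Set.indicator_of_notMem h0t, zero_mul]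
      convert measure_empty (μ := μ)
      rw [Set.eq_empty_iff_forall_notMem]
      intro ω h
      refine h0t ?_
      simpa [normalizedAttachment] using h 0 h0
  · rw [Finset.erase_eq_of_notMem h0] at hind
    rw [← hind]
    congr 1
    ext ω
    simp only [Set.mem_preimage, Set.mem_pi, Finset.mem_coe, Set.mem_iInter]
    refine forall₂_congr fun i hi => ?_
    rw [normalizedAttachment, if_neg (ne_of_mem_of_not_mem hi h0)]

end Transfer

theorem ae_eventually_moreCentralAt {v w : ℕ} (hv : 1 ≤ v) (hw : 1 ≤ w) (hvw : v ≠ w) :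
    ∀ᵐ u ∂recursiveTreeLaw, ∃ N,
      (∀ n, N ≤ n → MoreCentralAt u n v w) ∨ (∀ n, N ≤ n → MoreCentralAt u n w v) := by
  rcases lt_or_gt_of_ne hvw with h | h
  · filter_upwards [ae_regularAttachment, ae_not_asymptoticTie hv h] with u hu htie
    exact hu.eventually_moreCentralAt hv hw htie
  · filter_upwards [ae_regularAttachment, ae_not_asymptoticTie hw h] with u hu htie
    obtain ⟨N, hN⟩ := hu.eventually_moreCentralAt hw hv htie
    exact ⟨N, hN.symm⟩

theorem mainTheorem8 {Ω : Type*} [MeasurableSpace Ω] (μ : Measure Ω) [IsProbabilityMeasure μ]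
    (U : ℕ → Ω → ℕ) (hU : IsUniformAttachment μ U) :
    Persistent μ (fun n ω => rootRank (fun m => U m ω) n) ∧
    (∀ᵐ ω ∂μ, {v : ℕ | ∃ n, MoreCentralAt (fun m => U m ω) n v 1}.Finite) ∧
    (∀ v w : ℕ, 1 ≤ v → 1 ≤ w → v ≠ w → ∀ᵐ ω ∂μ, ∃ N : ℕ,
      (∀ n, N ≤ n → MoreCentralAt (fun m => U m ω) n v w) ∨
      (∀ n, N ≤ n → MoreCentralAt (fun m => U m ω) n w v)) := by
  have hae : ∀ {p : (ℕ → ℕ) → Prop}, (∀ᵐ u ∂recursiveTreeLaw, p u) →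
      ∀ᵐ ω ∂μ, p (normalizedAttachment U ω) := fun h => by
    rw [← map_normalizedAttachment hU] at h
    exact ae_of_ae_map (measurable_normalizedAttachment hU).aemeasurable h
  have hcongr : ∀ ω n m, 1 ≤ m → m < n → U m ω = normalizedAttachment U ω m :=
    fun ω n m hm _ => by rw [normalizedAttachment, if_neg (by omega)]
  have hrank : ∀ ω n, rootRank (fun m => U m ω) n = rootRank (normalizedAttachment U ω) n :=
    fun ω n => rootRank_congr (hcongr ω n)
  have hcentral : ∀ ω n v w, MoreCentralAt (fun m => U m ω) n v w ↔
      MoreCentralAt (normalizedAttachment U ω) n v w :=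
    fun ω n v w => moreCentralAt_congr (hcongr ω n) v w
  simp only [hrank, hcentral]
  have hfin : ∀ᵐ u ∂recursiveTreeLaw, {v : ℕ | ∃ n, MoreCentralAt u n v 1}.Finite :=
    ae_regularAttachment.mono fun u hu => hu.finite_moreCentral_root
  refine ⟨persistent_of_ae_eventually_const
    (fun n => (measurable_rootRank n).comp (measurable_normalizedAttachment hU)) ?_, hae hfin,
    fun v w hv hw hvw => hae (ae_eventually_moreCentralAt hv hw hvw)⟩
  refine hae (p := fun u => ∃ N, ∀ n, N ≤ n → rootRank u n = rootRank u N) ?_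
  have hord : ∀ᵐ u ∂recursiveTreeLaw, ∀ v, 1 ≤ v → v ≠ 1 → ∃ N,
      (∀ n, N ≤ n → MoreCentralAt u n v 1) ∨ (∀ n, N ≤ n → MoreCentralAt u n 1 v) := by
    refine ae_all_iff.2 fun v => ?_
    by_cases hv : 1 ≤ v ∧ v ≠ 1
    · filter_upwards [ae_eventually_moreCentralAt hv.1 le_rfl hv.2] with u hu _ _ using hu
    · exact ae_of_all _ fun u h1 h2 => absurd ⟨h1, h2⟩ hv
  filter_upwards [hfin, hord] with u h1 h2
  exact rootRank_eventually_const h1 h2
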